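/- Let $(M,\varphi,\xi,\eta,g)$ be an almost contact metric manifold of dimension $2m+1\ge 5$ (so $g$ is a Riemannian metric, $\varphi^2=-\mathrm{Id}+\eta\otimes\xi$, $\eta(\xi)=1$ and $g(\varphi X,\varphi Y)=g(X,Y)-\eta(X)\eta(Y)$), with Levi-Civita connection $\nabla$ and fundamental form $\phi(X,Y)=g(X,\varphi Y)$. Let $(M',J,g')$ be an almost Hermitian manifold of dimension $2n\ge 2$. (I) Let $\pi:M\to M'$ be a contact-complex Riemannian submersion, i.e. a (surjective) Riemannian submersion with $J\circ\pi_*=\pi_*\circ\varphi$, and let $\omega$ be a 1-form on $M$ such that $d\phi=-2\,\omega\wedge\phi$, where $3\,d\phi(X,Y,Z)$ is the cyclic sum over $(X,Y,Z)$ of $X(\phi(Y,Z))-\phi([X,Y],Z)$, and $3(\omega\wedge\phi)(X,Y,Z)=\omega(X)\phi(Y,Z)+\omega(Y)\phi(Z,X)+\omega(Z)\phi(X,Y)$ (such an $\omega$ is necessarily the Lee form of $M$). Let $v$ and $h$ denote the orthogonal projections of $TM$ onto $\ker\pi_*$ and $(\ker\pi_*)^\perp$, let $A_EF=v(\nabla_{hE}hF)+h(\nabla_{hE}vF)$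 be O'Neill's tensor, and let $B=\omega^\sharp$ be the vector field dual to $\omega$. Then: 1. $\delta\eta=0$, where $\delta\eta=-\sum_i(\nabla_{e_i}\eta)(e_i)$ for a local orthonormal frame $(e_i)$; 2. for all horizontal vector fields $X,Y$ and all vertical vector fields $U$ on $M$, $$A_XU=\eta(U)A_X\xi-\omega(\varphi U)\,\varphi X,$$ $$A_XY=\eta(A_XY)\,\xi+\phi(X,Y)\,v(\varphi B),$$ $$A_{\varphi X}U-\varphi(A_XU)=\eta(U)\bigl(A_{\varphi X}\xi-\varphi(A_X\xi)\bigr),$$ $$A_XY-A_{\varphi X}\varphi Y=\eta\bigl(A_XY-A_{\varphi X}\varphi Y\bigr)\,\xi.$$ (II) If $M$ is an $\alpha$-Kenmotsu manifold, i.e. $(\nabla_X\varphi)Y=\alpha\bigl(g(\varphi X,Y)\xi-\eta(Y)\varphi X\bigr)$ for all vector fields $X,Y$, where $\alpha$ is a function on $M$ that is not identically zero (for instance a non-zero constant, $M$ being non-empty), then there is no contact-complex Riemannian submersion from $M$ onto $M'$. -/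

import Mathlib

open Bundle NormedSpace VectorField
open scoped Manifold ContDiff

noncomputable section

set_option linter.unusedSectionVars false

namespace ContactComplex

section LeviCivita

variable {E : Type*} [NormedAddCommGroup E] [NormedSpace ℝ E] [FiniteDimensional ℝ E]
  {H : Type*} [TopologicalSpace H] {I : ModelWithCorners ℝ E H}
  {M : Type*} [TopologicalSpace M] [ChartedSpace H M]

instance tangentSpace_finiteDimensional (x : M) : FiniteDimensional ℝ (TangentSpace I x) :=
  inferInstanceAs (FiniteDimensional ℝ E)

variable [RiemannianBundle (fun x : M ↦ TangentSpace I x)]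

/-- Half of the right-hand side of Koszul's formula, at the point `x`. -/
def koszul (X Y Z : Π x : M, TangentSpace I x) (x : M) : ℝ :=
  (1 / 2 : ℝ) *
    (d% (fun y ↦ inner ℝ (Y y) (Z y)) x (X x)
      + d% (fun y ↦ inner ℝ (Z y) (X y)) x (Y x)
      - d% (fun y ↦ inner ℝ (X y) (Y y)) x (Z x)
      + inner ℝ (mlieBracket I X Y x) (Z x)
      - inner ℝ (mlieBracket I Y Z x) (X x)
      + inner ℝ (mlieBracket I Z X x) (Y x))

variable [IsManifold I ∞ M]
  [IsContMDiffRiemannianBundle I ∞ E (fun x : M ↦ TangentSpace I x)]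
variable {X Y Z : Π x : M, TangentSpace I x} {f : M → ℝ} {x : M}

theorem mdifferentiableAt_inner (hX : MDiffAt (T% X) x) (hY : MDiffAt (T% Y) x) :
    MDiffAt (fun y ↦ (inner ℝ (X y) (Y y) : ℝ)) x :=
  MDifferentiableAt.inner_bundle (E := fun x : M ↦ TangentSpace I x) hX hY

theorem mvfderiv_inner_smul_left (hf : MDiffAt f x) (hX : MDiffAt (T% X) x)
    (hY : MDiffAt (T% Y) x) (v : TangentSpace I x) :
    d% (fun y ↦ (inner ℝ ((f • X) y) (Y y) : ℝ)) x v =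
      f x * d% (fun y ↦ (inner ℝ (X y) (Y y) : ℝ)) x v + inner ℝ (X x) (Y x) * d% f x v := by
  have e : (fun y ↦ (inner ℝ ((f • X) y) (Y y) : ℝ)) = f * fun y ↦ inner ℝ (X y) (Y y) := by
    ext y; simp [inner_smul_left]
  rw [e, mvfderiv_mul hf (mdifferentiableAt_inner hX hY)]
  simp

theorem mvfderiv_inner_smul_right (hf : MDiffAt f x) (hX : MDiffAt (T% X) x)
    (hY : MDiffAt (T% Y) x) (v : TangentSpace I x) :
    d% (fun y ↦ (inner ℝ (Y y) ((f • X) y) : ℝ)) x v =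
      f x * d% (fun y ↦ (inner ℝ (Y y) (X y) : ℝ)) x v + inner ℝ (Y x) (X x) * d% f x v := by
  have e : (fun y ↦ (inner ℝ (Y y) ((f • X) y) : ℝ)) = f * fun y ↦ inner ℝ (Y y) (X y) := by
    ext y; simp [inner_smul_right]
  rw [e, mvfderiv_mul hf (mdifferentiableAt_inner hY hX)]
  simp

theorem mvfderiv_inner_add_left {X' : Π x : M, TangentSpace I x} (hX : MDiffAt (T% X) x)
    (hX' : MDiffAt (T% X') x) (hY : MDiffAt (T% Y) x) (v : TangentSpace I x) :
    d% (fun y ↦ (inner ℝ ((X + X') y) (Y y) : ℝ)) x v =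
      d% (fun y ↦ (inner ℝ (X y) (Y y) : ℝ)) x v
        + d% (fun y ↦ (inner ℝ (X' y) (Y y) : ℝ)) x v := by
  have e : (fun y ↦ (inner ℝ ((X + X') y) (Y y) : ℝ)) =
      (fun y ↦ inner ℝ (X y) (Y y)) + fun y ↦ inner ℝ (X' y) (Y y) := by
    ext y; simp [inner_add_left]
  rw [e, mvfderiv_add (mdifferentiableAt_inner hX hY) (mdifferentiableAt_inner hX' hY)]
  simp

theorem mvfderiv_inner_add_right {X' : Π x : M, TangentSpace I x} (hX : MDiffAt (T% X) x)
    (hX' : MDiffAt (T% X') x) (hY : MDiffAt (T% Y) x) (v : TangentSpace I x) :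
    d% (fun y ↦ (inner ℝ (Y y) ((X + X') y) : ℝ)) x v =
      d% (fun y ↦ (inner ℝ (Y y) (X y) : ℝ)) x v
        + d% (fun y ↦ (inner ℝ (Y y) (X' y) : ℝ)) x v := by
  have e : (fun y ↦ (inner ℝ (Y y) ((X + X') y) : ℝ)) =
      (fun y ↦ inner ℝ (Y y) (X y)) + fun y ↦ inner ℝ (Y y) (X' y) := by
    ext y; simp [inner_add_right]
  rw [e, mvfderiv_add (mdifferentiableAt_inner hY hX) (mdifferentiableAt_inner hY hX')]
  simp

theorem koszul_tensorial_left (hY : MDiffAt (T% Y) x) (hZ : MDiffAt (T% Z) x) :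
    TensorialAt I E (fun X ↦ koszul X Y Z x) x where
  smul {f X} hf hX := by
    have := FiniteDimensional.complete ℝ E
    simp only [koszul]
    rw [mvfderiv_inner_smul_left hf hX hY, mvfderiv_inner_smul_right hf hX hZ,
      mlieBracket_smul_left hf hX, mlieBracket_smul_right hf hX]
    simp only [Pi.smul_apply', inner_add_left, inner_smul_left, inner_smul_right, map_smul,
      smul_eq_mul, neg_smul, inner_neg_left, conj_trivial, real_inner_comm (X x)]
    ring
  add {X X'} hX hX' := by
    have := FiniteDimensional.complete ℝ E
    simp only [koszul]
    rw [mvfderiv_inner_add_left hX hX' hY, mvfderiv_inner_add_right hX hX' hZ,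
      mlieBracket_add_left hX hX', mlieBracket_add_right hX hX']
    simp only [Pi.add_apply, inner_add_left, inner_add_right, map_add]
    ring

theorem koszul_tensorial_right (hX : MDiffAt (T% X) x) (hY : MDiffAt (T% Y) x) :
    TensorialAt I E (fun Z ↦ koszul X Y Z x) x where
  smul {f Z} hf hZ := by
    have := FiniteDimensional.complete ℝ E
    simp only [koszul]
    rw [mvfderiv_inner_smul_left hf hZ hX, mvfderiv_inner_smul_right hf hZ hY,
      mlieBracket_smul_left hf hZ, mlieBracket_smul_right hf hZ]
    simp only [Pi.smul_apply', inner_add_left, inner_smul_left, inner_smul_right, map_smul,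
      smul_eq_mul, neg_smul, inner_neg_left, conj_trivial, real_inner_comm (Z x)]
    ring
  add {Z Z'} hZ hZ' := by
    have := FiniteDimensional.complete ℝ E
    simp only [koszul]
    rw [mvfderiv_inner_add_left hZ hZ' hX, mvfderiv_inner_add_right hZ hZ' hY,
      mlieBracket_add_left hZ hZ', mlieBracket_add_right hZ hZ']
    simp only [Pi.add_apply, inner_add_left, inner_add_right, map_add]
    ring

theorem koszul_add_middle {Y' : Π x : M, TangentSpace I x} (hX : MDiffAt (T% X) x)
    (hY : MDiffAt (T% Y) x) (hY' : MDiffAt (T% Y') x) (hZ : MDiffAt (T% Z) x) :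
    koszul X (Y + Y') Z x = koszul X Y Z x + koszul X Y' Z x := by
  have := FiniteDimensional.complete ℝ E
  simp only [koszul]
  rw [mvfderiv_inner_add_left hY hY' hZ, mvfderiv_inner_add_right hY hY' hX,
    mlieBracket_add_left hY hY', mlieBracket_add_right hY hY']
  simp only [Pi.add_apply, inner_add_left, inner_add_right, map_add]
  ring

theorem koszul_smul_middle (hf : MDiffAt f x) (hX : MDiffAt (T% X) x)
    (hY : MDiffAt (T% Y) x) (hZ : MDiffAt (T% Z) x) :
    koszul X (f • Y) Z x = f x * koszul X Y Z x + d% f x (X x) * inner ℝ (Y x) (Z x) := by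
  have := FiniteDimensional.complete ℝ E
  simp only [koszul]
  rw [mvfderiv_inner_smul_left hf hY hZ, mvfderiv_inner_smul_right hf hY hX,
    mlieBracket_smul_left hf hY, mlieBracket_smul_right hf hY]
  simp only [Pi.smul_apply', inner_add_left, inner_smul_left, inner_smul_right, map_smul,
    smul_eq_mul, neg_smul, inner_neg_left, conj_trivial, real_inner_comm (Y x)]
  ring

variable (x) in
/-- The bilinear form `(u, w) ↦ g(∇_u Y, w)` on the tangent space at `x` given by Koszul's formula,
for a vector field `Y` that is differentiable at `x`. -/
def koszulForm (Y : Π x : M, TangentSpace I x) (hY : MDiffAt (T% Y) x) :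
    TangentSpace I x →L[ℝ] TangentSpace I x →L[ℝ] ℝ :=
  TensorialAt.mkHom₂ (I := I) (F := E) (F' := E) (fun X Z ↦ koszul X Y Z x) x
    (fun _ hZ ↦ koszul_tensorial_left hY hZ) (fun _ hX ↦ koszul_tensorial_right hX hY)

theorem koszulForm_apply (hX : MDiffAt (T% X) x) (hY : MDiffAt (T% Y) x) (hZ : MDiffAt (T% Z) x) :
    koszulForm x Y hY (X x) (Z x) = koszul X Y Z x :=
  TensorialAt.mkHom₂_apply (I := I) (F := E) (F' := E) (Φ := fun X Z ↦ koszul X Y Z x)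
    (fun _ hZ ↦ koszul_tensorial_left hY hZ) (fun _ hX ↦ koszul_tensorial_right hX hY) hX hZ

open Classical in
/-- `leviCivitaFun Y x u` is `(∇_u Y)(x)`: the tangent vector that represents the linear form
`w ↦ g(∇_u Y, w)` of Koszul's formula. It is set to `0` if `Y` is not differentiable at `x`. -/
def leviCivitaFun (Y : Π x : M, TangentSpace I x) (x : M) :
    TangentSpace I x →L[ℝ] TangentSpace I x :=
  haveI : CompleteSpace (TangentSpace I x) := FiniteDimensional.complete ℝ _
  if hY : MDiffAt (T% Y) x then
    LinearMap.toContinuousLinearMap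
      { toFun := fun u ↦ (InnerProductSpace.toDual ℝ (TangentSpace I x)).symm (koszulForm x Y hY u)
        map_add' := by intro u v; simp
        map_smul' := by intro c u; simp }
  else 0

theorem inner_leviCivitaFun (hX : MDiffAt (T% X) x) (hY : MDiffAt (T% Y) x)
    (hZ : MDiffAt (T% Z) x) :
    inner ℝ (leviCivitaFun Y x (X x)) (Z x) = koszul X Y Z x := by
  have : CompleteSpace (TangentSpace I x) := FiniteDimensional.complete ℝ _
  rw [← koszulForm_apply hX hY hZ, leviCivitaFun, dif_pos hY]
  exact InnerProductSpace.toDual_symm_apply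

theorem eq_leviCivitaFun (hY : MDiffAt (T% Y) x) {L : TangentSpace I x →L[ℝ] TangentSpace I x}
    (h : ∀ X Z : Π x : M, TangentSpace I x, MDiffAt (T% X) x → MDiffAt (T% Z) x →
      inner ℝ (L (X x)) (Z x) = koszul X Y Z x) : leviCivitaFun Y x = L := by
  ext u
  refine ext_inner_right ℝ fun w ↦ ?_
  have hu : MDiffAt (T% (FiberBundle.extend E u)) x := FiberBundle.mdifferentiableAt_extend ..
  have hw : MDiffAt (T% (FiberBundle.extend E w)) x := FiberBundle.mdifferentiableAt_extend ..
  have h1 := inner_leviCivitaFun hu hY hw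
  have h2 := h _ _ hu hw
  simp only [FiberBundle.extend_apply_self] at h1 h2
  rw [h1, h2]

variable (I M) in
/-- The Levi-Civita connection of a Riemannian manifold; `leviCivita I M Y x u` is `(∇_u Y)(x)`. -/
def leviCivita : CovariantDerivative I E (TangentSpace I : M → Type _) where
  toFun := leviCivitaFun
  isCovariantDerivativeOnUniv :=
    { add := by
        intro Y Y' x hY hY' _
        refine eq_leviCivitaFun (mdifferentiableAt_add_section hY hY') fun X Z hX hZ ↦ ?_
        rw [koszul_add_middle hX hY hY' hZ, ← inner_leviCivitaFun hX hY hZ,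
          ← inner_leviCivitaFun hX hY' hZ, ← inner_add_left]
        rfl
      leibniz := by
        intro Y f x hY hf _
        refine eq_leviCivitaFun (hf.smul_section hY) fun X Z hX hZ ↦ ?_
        rw [koszul_smul_middle hf hX hY hZ, ← inner_leviCivitaFun hX hY hZ]
        simp [inner_add_left, inner_smul_left] }

theorem inner_leviCivita (hX : MDiffAt (T% X) x) (hY : MDiffAt (T% Y) x)
    (hZ : MDiffAt (T% Z) x) :
    inner ℝ (leviCivita I M Y x (X x)) (Z x) = koszul X Y Z x :=
  inner_leviCivitaFun hX hY hZ

/-- The Levi-Civita connection is compatible with the metric. -/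
theorem leviCivita_metric (hX : MDiffAt (T% X) x) (hY : MDiffAt (T% Y) x)
    (hZ : MDiffAt (T% Z) x) :
    d% (fun y ↦ (inner ℝ (Y y) (Z y) : ℝ)) x (X x) =
      inner ℝ (leviCivita I M Y x (X x)) (Z x) + inner ℝ (Y x) (leviCivita I M Z x (X x)) := by
  rw [real_inner_comm _ (Y x), inner_leviCivita hX hY hZ, inner_leviCivita hX hZ hY]
  have e (A B : Π x : M, TangentSpace I x) :
      (fun y ↦ (inner ℝ (A y) (B y) : ℝ)) = fun y ↦ inner ℝ (B y) (A y) := by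
    ext y; rw [real_inner_comm]
  simp only [koszul]
  rw [e Z Y, e X Z, e Y X, mlieBracket_swap_apply (V := Z) (W := Y),
    mlieBracket_swap_apply (V := X) (W := Z), mlieBracket_swap_apply (V := Y) (W := X)]
  simp only [inner_neg_left]
  ring

/-- The Levi-Civita connection has no torsion. -/
theorem leviCivita_torsion (hX : MDiffAt (T% X) x) (hY : MDiffAt (T% Y) x) :
    leviCivita I M Y x (X x) - leviCivita I M X x (Y x) = mlieBracket I X Y x := by
  refine ext_inner_right ℝ fun w ↦ ?_
  have hw : MDiffAt (T% (FiberBundle.extend E w)) x := FiberBundle.mdifferentiableAt_extend ..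
  have h1 := inner_leviCivita hX hY hw
  have h2 := inner_leviCivita hY hX hw
  have e (A B : Π x : M, TangentSpace I x) :
      (fun y ↦ (inner ℝ (A y) (B y) : ℝ)) = fun y ↦ inner ℝ (B y) (A y) := by
    ext y; rw [real_inner_comm]
  have s1 := mlieBracket_swap_apply (I := I) (V := Y) (W := X) (x := x)
  have s2 := mlieBracket_swap_apply (I := I) (V := X) (W := FiberBundle.extend E w) (x := x)
  have s3 := mlieBracket_swap_apply (I := I) (V := FiberBundle.extend E w) (W := Y) (x := x)
  simp only [koszul] at h1 h2
  rw [e Y X, e _ Y, e X _, s1, s2, s3] at h2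
  simp only [FiberBundle.extend_apply_self, inner_neg_left] at h1 h2
  rw [inner_sub_left, h1, h2]
  ring

end LeviCivita
section Structures

variable {E : Type*} [NormedAddCommGroup E] [NormedSpace ℝ E] [FiniteDimensional ℝ E]
  {H : Type*} [TopologicalSpace H] (I : ModelWithCorners ℝ E H)
  (M : Type*) [TopologicalSpace M] [ChartedSpace H M] [IsManifold I ∞ M]
  [RiemannianBundle (fun x : M ↦ TangentSpace I x)]
  [IsContMDiffRiemannianBundle I ∞ E (fun x : M ↦ TangentSpace I x)]

/-- An almost contact metric structure `(φ, ξ, η, g)`; the metric `g` is the given Riemannian metric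
of the manifold. -/
structure AlmostContactMetricStructure where
  /-- the `(1,1)`-tensor field `φ` -/
  phi : Π x : M, TangentSpace I x →L[ℝ] TangentSpace I x
  /-- the characteristic vector field `ξ` -/
  xi : Π x : M, TangentSpace I x
  /-- the 1-form `η` -/
  eta : Π x : M, TangentSpace I x →L[ℝ] ℝ
  phi_smooth : ContMDiff I (I.prod 𝓘(ℝ, E →L[ℝ] E)) ∞
    (fun x ↦ TotalSpace.mk' (E →L[ℝ] E) (E := fun x : M ↦ TangentSpace I x →L[ℝ] TangentSpace I x)
      x (phi x))
  xi_smooth : CMDiff ∞ (T% xi)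
  eta_smooth : ContMDiff I (I.prod 𝓘(ℝ, E →L[ℝ] ℝ)) ∞
    (fun x ↦ TotalSpace.mk' (E →L[ℝ] ℝ) (E := fun x : M ↦ TangentSpace I x →L[ℝ] Trivial M ℝ x)
      x (eta x))
  phi_phi : ∀ (x : M) (u : TangentSpace I x), phi x (phi x u) = -u + eta x u • xi x
  eta_xi : ∀ x : M, eta x (xi x) = 1
  inner_phi_phi : ∀ (x : M) (u v : TangentSpace I x),
    (inner ℝ (phi x u) (phi x v) : ℝ) = inner ℝ u v - eta x u * eta x v

/-- An almost Hermitian structure `(J, g)`; the metric `g` is the given Riemannian metric of the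
manifold. -/
structure AlmostHermitianStructure where
  /-- the almost complex structure `J` -/
  J : Π x : M, TangentSpace I x →L[ℝ] TangentSpace I x
  J_smooth : ContMDiff I (I.prod 𝓘(ℝ, E →L[ℝ] E)) ∞
    (fun x ↦ TotalSpace.mk' (E →L[ℝ] E) (E := fun x : M ↦ TangentSpace I x →L[ℝ] TangentSpace I x)
      x (J x))
  J_J : ∀ (x : M) (u : TangentSpace I x), J x (J x u) = -u
  inner_J_J : ∀ (x : M) (u v : TangentSpace I x),
    (inner ℝ (J x u) (J x v) : ℝ) = inner ℝ u v

end Structures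

section Forms

variable {E : Type*} [NormedAddCommGroup E] [NormedSpace ℝ E] [FiniteDimensional ℝ E]
  {H : Type*} [TopologicalSpace H] {I : ModelWithCorners ℝ E H}
  {M : Type*} [TopologicalSpace M] [ChartedSpace H M] [IsManifold I ∞ M]

/-- The exterior derivative of a smooth 2-form `β`, as a 3-form:
`3 dβ(X, Y, Z) = X β(Y, Z) + Y β(Z, X) + Z β(X, Y) - β([X, Y], Z) - β([Y, Z], X) - β([Z, X], Y)`.
The right-hand side is tensorial, so it may be evaluated on any local extensions `X`, `Y`, `Z` of the
tangent vectors `u`, `v`, `w` at `x`. -/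
def extDerivTwoForm (β : Π x : M, TangentSpace I x → TangentSpace I x → ℝ) (x : M)
    (u v w : TangentSpace I x) : ℝ :=
  let X : Π y : M, TangentSpace I y := FiberBundle.extend E u
  let Y : Π y : M, TangentSpace I y := FiberBundle.extend E v
  let Z : Π y : M, TangentSpace I y := FiberBundle.extend E w
  (1 / 3 : ℝ) *
    (d% (fun y ↦ β y (Y y) (Z y)) x u + d% (fun y ↦ β y (Z y) (X y)) x v
      + d% (fun y ↦ β y (X y) (Y y)) x w
      - β x (mlieBracket I X Y x) w - β x (mlieBracket I Y Z x) u - β x (mlieBracket I Z X x) v)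

/-- The wedge product of a 1-form and a 2-form, with the same normalization as `extDerivTwoForm`:
`3 (θ ∧ β)(u, v, w) = θ(u) β(v, w) + θ(v) β(w, u) + θ(w) β(u, v)`. -/
def wedgeOneTwo (θ : Π x : M, TangentSpace I x →L[ℝ] ℝ)
    (β : Π x : M, TangentSpace I x → TangentSpace I x → ℝ) (x : M)
    (u v w : TangentSpace I x) : ℝ :=
  (1 / 3 : ℝ) * (θ x u * β x v w + θ x v * β x w u + θ x w * β x u v)

variable [RiemannianBundle (fun x : M ↦ TangentSpace I x)]

/-- The vector field `θ^♯` metrically dual to a 1-form `θ`. -/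
def sharp (θ : Π x : M, TangentSpace I x →L[ℝ] ℝ) (x : M) : TangentSpace I x :=
  haveI : CompleteSpace (TangentSpace I x) := FiniteDimensional.complete ℝ _
  (InnerProductSpace.toDual ℝ (TangentSpace I x)).symm (θ x)

variable [IsContMDiffRiemannianBundle I ∞ E (fun x : M ↦ TangentSpace I x)]

/-- `(∇_u θ)(w) = u(θ(W)) - θ(∇_u W)` for a smooth 1-form `θ` and tangent vectors `u`, `w` at `x`,
where `W` is a local extension of `w` (the value does not depend on its choice). -/
def covDerivOneForm (θ : Π x : M, TangentSpace I x →L[ℝ] ℝ) (x : M)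
    (u w : TangentSpace I x) : ℝ :=
  let W : Π y : M, TangentSpace I y := FiberBundle.extend E w
  d% (fun y ↦ θ y (W y)) x u - θ x (leviCivita I M W x u)

/-- The codifferential `δθ = -∑ᵢ (∇_{eᵢ} θ)(eᵢ)` of a smooth 1-form, where `(eᵢ)` is an orthonormal
basis of the tangent space. -/
def codiff (θ : Π x : M, TangentSpace I x →L[ℝ] ℝ) (x : M) : ℝ :=
  -∑ i, covDerivOneForm θ x (stdOrthonormalBasis ℝ (TangentSpace I x) i)
    (stdOrthonormalBasis ℝ (TangentSpace I x) i)

/-- `(∇_u Φ)(w) = ∇_u (Φ W) - Φ(∇_u W)` for a smooth `(1,1)`-tensor field `Φ` and tangent vectors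
`u`, `w` at `x`, where `W` is a local extension of `w` (the value does not depend on its choice). -/
def covDerivEnd (Φ : Π x : M, TangentSpace I x →L[ℝ] TangentSpace I x) (x : M)
    (u w : TangentSpace I x) : TangentSpace I x :=
  let W : Π y : M, TangentSpace I y := FiberBundle.extend E w
  leviCivita I M (fun y ↦ Φ y (W y)) x u - Φ x (leviCivita I M W x u)

namespace AlmostContactMetricStructure

/-- The fundamental form `φ(X, Y) = g(X, φ Y)`. -/
def fundamentalForm (S : AlmostContactMetricStructure I M) (x : M) (u v : TangentSpace I x) : ℝ :=
  inner ℝ u (S.phi x v)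

/-- The vector field `φ X`. -/
def phiField (S : AlmostContactMetricStructure I M) (X : Π x : M, TangentSpace I x) :
    Π x : M, TangentSpace I x :=
  fun x ↦ S.phi x (X x)

/-- `M` is an `α`-Kenmotsu manifold: `(∇_X φ) Y = α (g(φ X, Y) ξ - η(Y) φ X)`. -/
def IsAlphaKenmotsu (S : AlmostContactMetricStructure I M) (α : M → ℝ) : Prop :=
  ∀ (x : M) (u w : TangentSpace I x),
    covDerivEnd S.phi x u w =
      α x • ((inner ℝ (S.phi x u) w : ℝ) • S.xi x - S.eta x w • S.phi x u)

end AlmostContactMetricStructure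

end Forms

section Submersions

variable {E : Type*} [NormedAddCommGroup E] [NormedSpace ℝ E] [FiniteDimensional ℝ E]
  {H : Type*} [TopologicalSpace H] (I : ModelWithCorners ℝ E H)
  {M : Type*} [TopologicalSpace M] [ChartedSpace H M] [IsManifold I ∞ M]
  [RiemannianBundle (fun x : M ↦ TangentSpace I x)]
  {E' : Type*} [NormedAddCommGroup E'] [NormedSpace ℝ E'] [FiniteDimensional ℝ E']
  {H' : Type*} [TopologicalSpace H'] (I' : ModelWithCorners ℝ E' H')
  {M' : Type*} [TopologicalSpace M'] [ChartedSpace H' M'] [IsManifold I' ∞ M']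

/-- The vertical space `ker p_*` at `x`. Its orthogonal complement is the horizontal space. -/
def verticalSpace (p : M → M') (x : M) : Submodule ℝ (TangentSpace I x) :=
  LinearMap.ker (mfderiv I I' p x : TangentSpace I x →ₗ[ℝ] TangentSpace I' (p x))

/-- The vertical component of a vector field. -/
def vert (p : M → M') (X : Π x : M, TangentSpace I x) (x : M) : TangentSpace I x :=
  (verticalSpace I I' p x).starProjection (X x)

/-- The horizontal component of a vector field. -/
def hor (p : M → M') (X : Π x : M, TangentSpace I x) (x : M) : TangentSpace I x :=
  (verticalSpace I I' p x)ᗮ.starProjection (X x)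

/-- `X ∈ χ^v(M)`: smooth vertical vector fields. -/
def IsVerticalField (p : M → M') (X : Π x : M, TangentSpace I x) : Prop :=
  CMDiff ∞ (T% X) ∧ ∀ x, X x ∈ verticalSpace I I' p x

/-- `X ∈ χ^h(M)`: smooth horizontal vector fields. -/
def IsHorizontalField (p : M → M') (X : Π x : M, TangentSpace I x) : Prop :=
  CMDiff ∞ (T% X) ∧ ∀ x, X x ∈ (verticalSpace I I' p x)ᗮ

/-- O'Neill's tensor field `A_X Y = v(∇_{hX} hY) + h(∇_{hX} vY)`. -/
def oneillA [IsContMDiffRiemannianBundle I ∞ E (fun x : M ↦ TangentSpace I x)]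
    (p : M → M') (X Y : Π x : M, TangentSpace I x) : Π x : M, TangentSpace I x :=
  vert I I' p (fun x ↦ leviCivita I M (hor I I' p Y) x (hor I I' p X x))
    + hor I I' p (fun x ↦ leviCivita I M (vert I I' p Y) x (hor I I' p X x))

variable [RiemannianBundle (fun x : M' ↦ TangentSpace I' x)]

/-- A Riemannian submersion: a smooth surjective map whose differential is everywhere surjective and
preserves the lengths of horizontal vectors. -/
structure IsRiemannianSubmersion (p : M → M') : Prop where
  smooth : ContMDiff I I' ∞ p
  surjective : Function.Surjective p
  mfderiv_surjective : ∀ x, Function.Surjective (mfderiv I I' p x)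
  norm_mfderiv : ∀ x, ∀ u ∈ (verticalSpace I I' p x)ᗮ, ‖mfderiv I I' p x u‖ = ‖u‖

variable {I I'}
  [IsContMDiffRiemannianBundle I ∞ E (fun x : M ↦ TangentSpace I x)]
  [IsContMDiffRiemannianBundle I' ∞ E' (fun x : M' ↦ TangentSpace I' x)]

/-- A contact-complex Riemannian submersion: a Riemannian submersion with `J ∘ p_* = p_* ∘ φ`. -/
structure IsContactComplexSubmersion (S : AlmostContactMetricStructure I M)
    (T : AlmostHermitianStructure I' M') (p : M → M') : Prop
    extends IsRiemannianSubmersion I I' p where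
  J_mfderiv : ∀ (x : M) (u : TangentSpace I x),
    T.J (p x) (mfderiv I I' p x u) = mfderiv I I' p x (S.phi x u)

end Submersions

end ContactComplex

end

open ContactComplex

set_option linter.unusedSectionVars false

namespace ContactComplex

section Bracket

variable {E : Type*} [NormedAddCommGroup E] [NormedSpace ℝ E] [FiniteDimensional ℝ E]
  {M : Type*} [TopologicalSpace M] [ChartedSpace E M] [IsManifold 𝓘(ℝ, E) ∞ M]
  {V : Type*} [NormedAddCommGroup V] [NormedSpace ℝ V]
  {X Y : Π x : M, TangentSpace 𝓘(ℝ, E) x} {F : M → V} {x : M}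

theorem mvfderiv_eq_of_eventuallyEq_comp_extChartAt {g : M → V} {h : E → V} {y : M}
    (hy : y ∈ (chartAt E x).source)
    (hh : DifferentiableAt ℝ h (extChartAt 𝓘(ℝ, E) x y))
    (hg : g =ᶠ[nhds y] h ∘ extChartAt 𝓘(ℝ, E) x) (u : TangentSpace 𝓘(ℝ, E) y) :
    d% g y u = fderiv ℝ h (extChartAt 𝓘(ℝ, E) x y)
      (mfderiv 𝓘(ℝ, E) 𝓘(ℝ, E) (extChartAt 𝓘(ℝ, E) x) y u) := by
  have h1 : mfderiv 𝓘(ℝ, E) 𝓘(ℝ, V) g y =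
      mfderiv 𝓘(ℝ, E) 𝓘(ℝ, V) (h ∘ extChartAt 𝓘(ℝ, E) x) y := hg.mfderiv_eq
  have h2 := mfderiv_comp y hh.mdifferentiableAt
    (mdifferentiableAt_extChartAt (I := 𝓘(ℝ, E)) hy)
  rw [mfderiv_eq_fderiv] at h2
  change mfderiv 𝓘(ℝ, E) 𝓘(ℝ, V) g y u = _
  rw [h1, h2]
  rfl

/-- The derivative of a function along the bracket `[X, Y]` is the commutator of the derivatives
along `X` and `Y`. -/
theorem mvfderiv_mlieBracket (hF : CMDiffAt 2 F x) (hX : MDiffAt (T% X) x)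
    (hY : MDiffAt (T% Y) x) :
    d% F x (mlieBracket 𝓘(ℝ, E) X Y x) =
      d% (fun y ↦ d% F y (Y y)) x (X x) - d% (fun y ↦ d% F y (X y)) x (Y x) := by
  have := FiniteDimensional.complete ℝ E
  set χ := extChartAt 𝓘(ℝ, E) x with hχ
  set G : E → V := F ∘ χ.symm with hGdef
  have hG : ContDiffAt ℝ 2 G (χ x) := by
    have := contMDiffAt_iff_source.1 hF
    rw [modelWithCornersSelf_coe, Set.range_id, contMDiffWithinAt_univ] at this
    exact this.contDiffAt
  have hFG : ∀ y ∈ χ.source, F =ᶠ[nhds y] G ∘ χ := fun y hy ↦ by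
    filter_upwards [(isOpen_extChartAt_source x).mem_nhds hy] with z hz
    simp [hGdef, χ.left_inv hz]
  have hpull : ∀ W : Π x : M, TangentSpace 𝓘(ℝ, E) x, MDiffAt (T% W) x →
      DifferentiableAt ℝ (mpullbackWithin 𝓘(ℝ, E) 𝓘(ℝ, E) χ.symm W Set.univ) (χ x) := by
    intro W hW
    have h := MDifferentiableWithinAt.differentiableWithinAt_mpullbackWithin_vectorField
      (s := Set.univ) (mdifferentiableWithinAt_univ.2 hW)
    rw [modelWithCornersSelf_coe, Set.range_id, Set.preimage_univ, Set.univ_inter] at h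
    exact h.differentiableAt Filter.univ_mem
  have hpush : ∀ W : Π x : M, TangentSpace 𝓘(ℝ, E) x, ∀ y ∈ χ.source,
      mfderiv 𝓘(ℝ, E) 𝓘(ℝ, E) χ y (W y) =
        mpullbackWithin 𝓘(ℝ, E) 𝓘(ℝ, E) χ.symm W Set.univ (χ y) := by
    intro W y hy
    have h1 := mfderivWithin_extChartAt_symm_comp_mfderiv_extChartAt' (I := 𝓘(ℝ, E)) hy
    have h2 := isInvertible_mfderivWithin_extChartAt_symm (I := 𝓘(ℝ, E)) (χ.map_source hy)
    rw [modelWithCornersSelf_coe, Set.range_id] at h1 h2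
    rw [mpullbackWithin_apply]
    have h3 : ∀ z, z = y → (W z : E) = (W y : E) := by rintro _ rfl; rfl
    exact (h2.inverse_apply_eq.2 ((h3 _ (χ.left_inv hy)).trans
      (DFunLike.congr_fun h1 (W y)).symm)).symm
  have hev : ∀ᶠ y in nhds x, y ∈ χ.source ∧ DifferentiableAt ℝ G (χ y) := by
    refine Filter.Eventually.and (extChartAt_source_mem_nhds x) ?_
    have := (hG.eventually (by simp)).mono fun z hz ↦ hz.differentiableAt two_ne_zero
    exact (continuousAt_extChartAt x).eventually this
  have hd : ∀ W : Π x : M, TangentSpace 𝓘(ℝ, E) x,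
      (fun y ↦ d% F y (W y)) =ᶠ[nhds x]
        (fun z ↦ fderiv ℝ G z (mpullbackWithin 𝓘(ℝ, E) 𝓘(ℝ, E) χ.symm W Set.univ z)) ∘ χ := by
    intro W
    filter_upwards [hev] with y hy
    rw [mvfderiv_eq_of_eventuallyEq_comp_extChartAt (by simpa [χ] using hy.1) hy.2 (hFG y hy.1)]
    rw [← hχ, hpush W y hy.1]
    rfl
  have hG' : DifferentiableAt ℝ (fderiv ℝ G) (χ x) :=
    (hG.fderiv_right (m := 1) le_rfl).differentiableAt one_ne_zero
  have hx : x ∈ (chartAt E x).source := mem_chart_source E x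
  rw [mvfderiv_eq_of_eventuallyEq_comp_extChartAt hx (hG'.clm_apply (hpull _ hY)) (hd Y),
    mvfderiv_eq_of_eventuallyEq_comp_extChartAt hx (hG'.clm_apply (hpull _ hX)) (hd X),
    mvfderiv_eq_of_eventuallyEq_comp_extChartAt hx (hG.differentiableAt two_ne_zero)
      (hFG x (mem_extChartAt_source x)), ← hχ, hpush X x (mem_extChartAt_source x),
      hpush Y x (mem_extChartAt_source x),
      ← fderiv_apply_lieBracket hG (by simp) (hpull _ hY) (hpull _ hX)]
  rw [← mlieBracketWithin_univ, mlieBracketWithin_apply, modelWithCornersSelf_coe, Set.range_id,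
    Set.preimage_univ, Set.univ_inter]
  have h := isInvertible_mfderiv_extChartAt (I := 𝓘(ℝ, E)) (mem_extChartAt_source (I := 𝓘(ℝ, E)) x)
  exact congrArg _ ((h.self_apply_inverse _).trans (congrFun (lieBracketWithin_univ (𝕜 := ℝ) (E := E)) _))

end Bracket

section Related

variable {E : Type*} [NormedAddCommGroup E] [NormedSpace ℝ E] [FiniteDimensional ℝ E]
  {M : Type*} [TopologicalSpace M] [ChartedSpace E M] [IsManifold 𝓘(ℝ, E) ∞ M]
  {E' : Type*} [NormedAddCommGroup E'] [NormedSpace ℝ E'] [FiniteDimensional ℝ E']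
  {M' : Type*} [TopologicalSpace M'] [ChartedSpace E' M'] [IsManifold 𝓘(ℝ, E') ∞ M']
  {p : M → M'} {X U : Π x : M, TangentSpace 𝓘(ℝ, E) x} {X' : Π x : M', TangentSpace 𝓘(ℝ, E') x}
  {x : M}

/-- The vector fields `X` and `X'` are `p`-related near `x`. -/
def RelatedNear (p : M → M') (X : Π x : M, TangentSpace 𝓘(ℝ, E) x)
    (X' : Π x : M', TangentSpace 𝓘(ℝ, E') x) (x : M) : Prop :=
  ∀ᶠ y in nhds x, mfderiv 𝓘(ℝ, E) 𝓘(ℝ, E') p y (X y) = X' (p y)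

theorem mdifferentiableAt_mvfderiv_extChartAt (hX : MDiffAt (T% X) x) :
    MDiffAt (fun y ↦ d% (extChartAt 𝓘(ℝ, E) x) y (X y)) x := by
  have h := (mdifferentiableAt_section (F := E) (IB := 𝓘(ℝ, E)) X).1 hX
  refine h.congr_of_eventuallyEq ?_
  filter_upwards [extChartAt_source_mem_nhds (I := 𝓘(ℝ, E)) x] with y hy
  rw [extChartAt_source] at hy
  have h1 := TangentBundle.continuousLinearMapAt_trivializationAt (I := 𝓘(ℝ, E)) hy
  have h2 := (DFunLike.congr_fun h1 (X y)).symm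
  refine h2.trans ?_
  rw [Trivialization.continuousLinearMapAt_apply, Trivialization.linearMapAt_apply,
    if_pos (by simpa using hy)]

theorem mvfderiv_mfderiv_mlieBracket_eq_zero {V : Type*} [NormedAddCommGroup V] [NormedSpace ℝ V]
    {f : M' → V} (hp : ContMDiff 𝓘(ℝ, E) 𝓘(ℝ, E') ∞ p) (hf : CMDiffAt 2 f (p x))
    (hU : MDiffAt (T% U) x) (hX : MDiffAt (T% X) x)
    (hfX' : MDiffAt (fun z ↦ d% f z (X' z)) (p x))
    (hU0 : RelatedNear (E' := E') p U 0 x) (hXX' : RelatedNear p X X' x) :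
    d% f (p x) (mfderiv 𝓘(ℝ, E) 𝓘(ℝ, E') p x (mlieBracket 𝓘(ℝ, E) U X x)) = 0 := by
  have hpd : ∀ y, MDiffAt p y := fun y ↦ (hp y).mdifferentiableAt (by simp)
  have hF : CMDiffAt 2 (f ∘ p) x :=
    ContMDiffAt.comp x hf ((hp x).of_le ENat.LEInfty.out)
  have hcomp : ∀ᶠ y in nhds x, ∀ v : TangentSpace 𝓘(ℝ, E) y,
      d% (f ∘ p) y v = d% f (p y) (mfderiv 𝓘(ℝ, E) 𝓘(ℝ, E') p y v) := by
    have h2 : ∀ᶠ z in nhds (p x), MDiffAt f z :=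
      ((contMDiffAt_iff_contMDiffAt_nhds (by simp)).1 hf).mono fun z hz ↦ hz.mdifferentiableAt two_ne_zero
    filter_upwards [(hp x).continuousAt.eventually h2] with y hy v
    exact mfderiv_comp_apply y hy (hpd y) v
  have h0 : (fun y ↦ d% (f ∘ p) y (U y)) =ᶠ[nhds x] fun _ ↦ 0 := by
    filter_upwards [hcomp, hU0] with y hy hy'
    rw [hy, hy']
    exact map_zero _
  have h1 : (fun y ↦ d% (f ∘ p) y (X y)) =ᶠ[nhds x] (fun z ↦ d% f z (X' z)) ∘ p := by
    filter_upwards [hcomp, hXX'] with y hy hy'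
    rw [hy, hy']
    rfl
  have e0 : d% (fun y ↦ d% (f ∘ p) y (U y)) x (X x) = 0 := by
    have e : d% (fun y ↦ d% (f ∘ p) y (U y)) x = d% (fun _ : M ↦ (0 : V)) x := by
      ext v
      exact DFunLike.congr_fun (h0.mfderiv_eq (I := 𝓘(ℝ, E)) (I' := 𝓘(ℝ, V))) v
    rw [e, mvfderiv_const]
    rfl
  have e1 : d% (fun y ↦ d% (f ∘ p) y (X y)) x (U x) = 0 := by
    have e : d% (fun y ↦ d% (f ∘ p) y (X y)) x (U x) =
        d% (fun z ↦ d% f z (X' z)) (p x) (mfderiv 𝓘(ℝ, E) 𝓘(ℝ, E') p x (U x)) :=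
      (DFunLike.congr_fun (h1.mfderiv_eq (I := 𝓘(ℝ, E)) (I' := 𝓘(ℝ, V))) (U x)).trans
        (mfderiv_comp_apply x hfX' (hpd x) (U x))
    rw [e, hU0.self_of_nhds]
    exact map_zero _
  have key := mvfderiv_mlieBracket hF hU hX
  rw [hcomp.self_of_nhds, e0, e1, sub_zero] at key
  exact key

/-- The bracket of a vertical vector field and a projectable one is vertical. -/
theorem mfderiv_mlieBracket_eq_zero (hp : ContMDiff 𝓘(ℝ, E) 𝓘(ℝ, E') ∞ p)
    (hU : MDiffAt (T% U) x) (hX : MDiffAt (T% X) x) (hX' : MDiffAt (T% X') (p x))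
    (hU0 : RelatedNear (E' := E') p U 0 x) (hXX' : RelatedNear p X X' x) :
    mfderiv 𝓘(ℝ, E) 𝓘(ℝ, E') p x (mlieBracket 𝓘(ℝ, E) U X x) = 0 := by
  have key := mvfderiv_mfderiv_mlieBracket_eq_zero hp
    (contMDiffAt_extChartAt (I := 𝓘(ℝ, E')) (n := 2) (x := p x)) hU hX
    (mdifferentiableAt_mvfderiv_extChartAt hX') hU0 hXX'
  have h := isInvertible_mfderiv_extChartAt (I := 𝓘(ℝ, E'))
    (mem_extChartAt_source (I := 𝓘(ℝ, E')) (p x))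
  exact h.injective (Eq.trans key (map_zero _).symm)

end Related

section Extension

variable {E : Type*} [NormedAddCommGroup E] [NormedSpace ℝ E] [FiniteDimensional ℝ E]
  {M : Type*} [TopologicalSpace M] [ChartedSpace E M] [IsManifold 𝓘(ℝ, E) ∞ M]
  {E' : Type*} [NormedAddCommGroup E'] [NormedSpace ℝ E'] [FiniteDimensional ℝ E']
  {M' : Type*} [TopologicalSpace M'] [ChartedSpace E' M'] [IsManifold 𝓘(ℝ, E') ∞ M']
  {p : M → M'} {x : M}

/-- If `A` is a differentiable family of linear maps and `A x` is surjective, then every vector `u`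
extends to a differentiable family `c` of vectors with `A y (c y) = A x u` near `x`. -/
theorem exists_mdifferentiableAt_apply_eq {A : M → E →L[ℝ] E'} (hA : MDiffAt A x)
    (hs : Function.Surjective (A x)) (u : E) :
    ∃ c : M → E, c x = u ∧ MDiffAt c x ∧ ∀ᶠ y in nhds x, A y (c y) = A x u := by
  have := FiniteDimensional.complete ℝ E'
  obtain ⟨R, hR⟩ := (A x).exists_rightInverse_of_surjective (LinearMap.range_eq_top.2 hs)
  have hB : MDiffAt (fun y ↦ A y ∘L R) x := hA.clm_comp mdifferentiableAt_const
  have hBx : A x ∘L R = ((1 : (E' →L[ℝ] E')ˣ) : E' →L[ℝ] E') := hR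
  have hinv : MDiffAt (fun y ↦ Ring.inverse (A y ∘L R)) x := by
    have h : DifferentiableAt ℝ Ring.inverse (A x ∘L R) := by
      rw [hBx]; exact differentiableAt_inverse (Units.isUnit (1 : (E' →L[ℝ] E')ˣ))
    exact h.mdifferentiableAt.comp x hB
  refine ⟨fun y ↦ u - R (Ring.inverse (A y ∘L R) (A y u - A x u)), by simp, ?_, ?_⟩
  · have h1 : MDiffAt (fun y ↦ A y u - A x u) x :=
      (hA.clm_apply mdifferentiableAt_const).sub mdifferentiableAt_const
    have h2 : MDiffAt (fun y ↦ R (Ring.inverse (A y ∘L R) (A y u - A x u))) x :=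
      (mdifferentiableAt_const (c := R)).clm_apply (hinv.clm_apply h1)
    exact mdifferentiableAt_const.sub h2
  · have hu : ∀ᶠ y in nhds x, IsUnit (A y ∘L R) := by
      refine hB.continuousAt.eventually (Units.isOpen.mem_nhds ?_)
      change IsUnit (A x ∘L R)
      rw [hBx]
      exact Units.isUnit (1 : (E' →L[ℝ] E')ˣ)
    filter_upwards [hu] with y hy
    have h := DFunLike.congr_fun (Ring.mul_inverse_cancel _ hy) (A y u - A x u)
    simp only [mul_apply_eq_comp, ContinuousLinearMap.comp_apply,
      one_apply_eq_self] at h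
    rw [map_sub, h]
    abel

/-- Every tangent vector extends to a vector field that is projectable along a submersion. -/
theorem exists_relatedNear_extend (hp : ContMDiff 𝓘(ℝ, E) 𝓘(ℝ, E') ∞ p)
    (hs : Function.Surjective (mfderiv 𝓘(ℝ, E) 𝓘(ℝ, E') p x)) (u : TangentSpace 𝓘(ℝ, E) x) :
    ∃ X : Π y : M, TangentSpace 𝓘(ℝ, E) y, X x = u ∧ MDiffAt (T% X) x ∧
      RelatedNear p X (FiberBundle.extend E' (mfderiv 𝓘(ℝ, E) 𝓘(ℝ, E') p x u)) x := by
  set t := trivializationAt E (TangentSpace 𝓘(ℝ, E)) x with ht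
  set t' := trivializationAt E' (TangentSpace 𝓘(ℝ, E')) (p x) with ht'
  have hx : x ∈ t.baseSet := FiberBundle.mem_baseSet_trivializationAt' x
  have hx' : p x ∈ t'.baseSet := FiberBundle.mem_baseSet_trivializationAt' (p x)
  set A := inTangentCoordinates 𝓘(ℝ, E) 𝓘(ℝ, E') id p (mfderiv 𝓘(ℝ, E) 𝓘(ℝ, E') p) x
  have hA : MDiffAt A x :=
    ((ContMDiffAt.of_le (m := 2) (hp x) ENat.LEInfty.out).mfderiv_const (m := 1) one_add_one_eq_two.le).mdifferentiableAt one_ne_zero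
  have hnear : ∀ᶠ y in nhds x, y ∈ t.baseSet ∧ p y ∈ t'.baseSet :=
    Filter.Eventually.and (t.open_baseSet.mem_nhds hx)
      ((hp x).continuousAt (t'.open_baseSet.mem_nhds hx'))
  have hAy : ∀ y, y ∈ t.baseSet ∧ p y ∈ t'.baseSet → ∀ v : E,
      A y v = (t' ⟨p y, mfderiv 𝓘(ℝ, E) 𝓘(ℝ, E') p y (t.symm y v)⟩).2 := by
    intro y hy v
    exact DFunLike.congr_fun (ContinuousLinearMap.inCoordinates_eq
      (ϕ := mfderiv 𝓘(ℝ, E) 𝓘(ℝ, E') p y) hy.1 hy.2) v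
  have hsA : Function.Surjective (A x) := by
    intro w
    obtain ⟨v, hv⟩ := hs (t'.symm (p x) w)
    refine ⟨(t ⟨x, v⟩).2, ?_⟩
    rw [hAy x hnear.self_of_nhds, Trivialization.symm_apply_apply_mk _ hx, hv]
    simp [Trivialization.apply_mk_symm _ hx']
  obtain ⟨c, hcx, hc, hAc⟩ := exists_mdifferentiableAt_apply_eq hA hsA (t ⟨x, u⟩).2
  refine ⟨fun y ↦ t.symm y (c y), ?_, ?_, ?_⟩
  · simp only [hcx, Trivialization.symm_apply_apply_mk _ hx]
  · rw [t.mdifferentiableAt_section_iff 𝓘(ℝ, E) _ hx]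
    refine hc.congr_of_eventuallyEq ?_
    filter_upwards [hnear] with y hy
    simp [Trivialization.apply_mk_symm _ hy.1]
  · filter_upwards [hnear, hAc] with y hy hy'
    rw [hAy y hy, hAy x hnear.self_of_nhds, Trivialization.symm_apply_apply_mk _ hx] at hy'
    rw [FiberBundle.extend, ← ht', ← hy', Trivialization.symm_apply_apply_mk _ hy.2]

theorem eventually_extend_zero (x : M) :
    ∀ᶠ y in nhds x, FiberBundle.extend E (0 : TangentSpace 𝓘(ℝ, E) x) y =
      (0 : TangentSpace 𝓘(ℝ, E) y) := by
  set t := trivializationAt E (TangentSpace 𝓘(ℝ, E)) x with ht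
  have hx : x ∈ t.baseSet := FiberBundle.mem_baseSet_trivializationAt' x
  have h : (t ⟨x, 0⟩).2 = 0 := by
    simpa [hx] using! map_zero (t.linearMapAt ℝ x)
  filter_upwards [t.open_baseSet.mem_nhds hx] with y hy
  rw [FiberBundle.extend, ← ht, h, ← Trivialization.symmₗ_apply (R := ℝ) t hy]
  exact map_zero _

/-- Every vertical vector extends to a locally vertical vector field. -/
theorem exists_relatedNear_zero (hp : ContMDiff 𝓘(ℝ, E) 𝓘(ℝ, E') ∞ p)
    (hs : Function.Surjective (mfderiv 𝓘(ℝ, E) 𝓘(ℝ, E') p x)) {u : TangentSpace 𝓘(ℝ, E) x}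
    (hu : mfderiv 𝓘(ℝ, E) 𝓘(ℝ, E') p x u = 0) :
    ∃ U : Π y : M, TangentSpace 𝓘(ℝ, E) y, U x = u ∧ MDiffAt (T% U) x ∧
      RelatedNear (E' := E') p U 0 x := by
  obtain ⟨U, hUx, hU, hU'⟩ := exists_relatedNear_extend hp hs u
  refine ⟨U, hUx, hU, ?_⟩
  filter_upwards [hU', (hp x).continuousAt.eventually (eventually_extend_zero (E := E') (p x))] with y hy hy'
  rw [hy, hu, hy']
  rfl

end Extension

section AlmostContact

variable {E : Type*} [NormedAddCommGroup E] [NormedSpace ℝ E] [FiniteDimensional ℝ E]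
  {M : Type*} [TopologicalSpace M] [ChartedSpace E M] [IsManifold 𝓘(ℝ, E) ∞ M]
  [RiemannianBundle (fun x : M ↦ TangentSpace 𝓘(ℝ, E) x)]
  [IsContMDiffRiemannianBundle 𝓘(ℝ, E) ∞ E (fun x : M ↦ TangentSpace 𝓘(ℝ, E) x)]
  {X Y Z : Π x : M, TangentSpace 𝓘(ℝ, E) x} {x : M}

theorem mvfderiv_inner_eq (hY : MDiffAt (T% Y) x) (hZ : MDiffAt (T% Z) x)
    (u : TangentSpace 𝓘(ℝ, E) x) :
    d% (fun y ↦ (inner ℝ (Y y) (Z y) : ℝ)) x u =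
      inner ℝ (leviCivita 𝓘(ℝ, E) M Y x u) (Z x) + inner ℝ (Y x) (leviCivita 𝓘(ℝ, E) M Z x u) := by
  have h := leviCivita_metric (x := x)
    (FiberBundle.mdifferentiableAt_extend 𝓘(ℝ, E) E u) hY hZ
  rwa [FiberBundle.extend_apply_self] at h

theorem leviCivita_add (hX : MDiffAt (T% X) x) (hY : MDiffAt (T% Y) x)
    (u : TangentSpace 𝓘(ℝ, E) x) :
    leviCivita 𝓘(ℝ, E) M (X + Y) x u =
      leviCivita 𝓘(ℝ, E) M X x u + leviCivita 𝓘(ℝ, E) M Y x u := by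
  rw [(leviCivita 𝓘(ℝ, E) M).isCovariantDerivativeOnUniv.add hX hY]
  rfl

theorem leviCivita_smul {f : M → ℝ} (hf : MDiffAt f x) (hX : MDiffAt (T% X) x)
    (u : TangentSpace 𝓘(ℝ, E) x) :
    leviCivita 𝓘(ℝ, E) M (f • X) x u =
      f x • leviCivita 𝓘(ℝ, E) M X x u + d% f x u • X x := by
  rw [(leviCivita 𝓘(ℝ, E) M).isCovariantDerivativeOnUniv.leibniz hX hf]
  rfl

theorem leviCivita_neg (hX : MDiffAt (T% X) x) (u : TangentSpace 𝓘(ℝ, E) x) :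
    leviCivita 𝓘(ℝ, E) M (-X) x u = -leviCivita 𝓘(ℝ, E) M X x u := by
  have h := (leviCivita 𝓘(ℝ, E) M).isCovariantDerivativeOnUniv.smul_const (-1) hX
  rw [neg_one_smul, neg_one_smul] at h
  rw [h]
  rfl

namespace AlmostContactMetricStructure

variable (S : AlmostContactMetricStructure 𝓘(ℝ, E) M)

theorem phi_xi (x : M) : S.phi x (S.xi x) = 0 := by
  have hxi : S.xi x ≠ 0 := fun h ↦ by simpa [h] using S.eta_xi x
  have h1 : S.phi x (S.phi x (S.xi x)) = 0 := by simp [S.phi_phi, S.eta_xi]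
  have h2 := S.phi_phi x (S.phi x (S.xi x))
  rw [h1, map_zero] at h2
  have h3 : S.phi x (S.xi x) = S.eta x (S.phi x (S.xi x)) • S.xi x := by
    rw [← sub_eq_zero, sub_eq_neg_add, ← neg_eq_zero]
    rw [h2]
    abel
  set c := S.eta x (S.phi x (S.xi x)) with hc
  rw [h3, map_smul, h3, smul_smul, smul_eq_zero, or_iff_left hxi, mul_self_eq_zero] at h1
  rw [h3, h1, zero_smul]

theorem eta_eq_inner (x : M) (u : TangentSpace 𝓘(ℝ, E) x) : S.eta x u = inner ℝ u (S.xi x) := by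
  have h := S.inner_phi_phi x u (S.xi x)
  rw [S.phi_xi, inner_zero_right, S.eta_xi] at h
  linarith

theorem inner_xi_xi (x : M) : (inner ℝ (S.xi x) (S.xi x) : ℝ) = 1 := by
  rw [← S.eta_eq_inner, S.eta_xi]

theorem eta_phi (x : M) (u : TangentSpace 𝓘(ℝ, E) x) : S.eta x (S.phi x u) = 0 := by
  have hxi : S.xi x ≠ 0 := fun h ↦ by simpa [h] using S.eta_xi x
  have h := S.phi_phi x (S.phi x u)
  have h' := congrArg (S.phi x) (S.phi_phi x u)
  rw [h, map_add, map_neg, map_smul, S.phi_xi, smul_zero, add_right_inj] at h'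
  simpa [hxi] using h'

theorem inner_phi_left (x : M) (u v : TangentSpace 𝓘(ℝ, E) x) :
    (inner ℝ (S.phi x u) v : ℝ) = -inner ℝ u (S.phi x v) := by
  have h := S.inner_phi_phi x u (S.phi x v)
  rw [S.eta_phi, S.phi_phi, inner_add_right, inner_neg_right, inner_smul_right, ← S.eta_eq_inner,
    S.eta_phi] at h
  linarith

theorem mdifferentiableAt_xi : MDiffAt (T% S.xi) x :=
  (S.xi_smooth x).mdifferentiableAt (by simp)

theorem mdifferentiableAt_phiField (hX : MDiffAt (T% X) x) : MDiffAt (T% (S.phiField X)) x :=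
  ((S.phi_smooth x).mdifferentiableAt (by simp)).clm_bundle_apply hX

theorem phiField_phiField (X : Π x : M, TangentSpace 𝓘(ℝ, E) x) :
    S.phiField (S.phiField X) = -X + (fun y ↦ (inner ℝ (X y) (S.xi y) : ℝ)) • S.xi := by
  ext y
  simp [phiField, S.phi_phi, S.eta_eq_inner]

theorem covDerivEnd_tensorial (u : TangentSpace 𝓘(ℝ, E) x) :
    TensorialAt 𝓘(ℝ, E) E (fun W ↦ leviCivita 𝓘(ℝ, E) M (S.phiField W) x u
      - S.phi x (leviCivita 𝓘(ℝ, E) M W x u)) x where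
  smul {f W} hf hW := by
    have e : S.phiField (f • W) = f • S.phiField W := by ext y; simp [phiField]
    rw [e, leviCivita_smul hf (S.mdifferentiableAt_phiField hW), leviCivita_smul hf hW]
    simp [phiField, smul_sub]
  add {W W'} hW hW' := by
    have e : S.phiField (W + W') = S.phiField W + S.phiField W' := by ext y; simp [phiField]
    rw [e, leviCivita_add (S.mdifferentiableAt_phiField hW) (S.mdifferentiableAt_phiField hW'),
      leviCivita_add hW hW', map_add]
    abel

theorem covDerivEnd_phi (hY : MDiffAt (T% Y) x) (u : TangentSpace 𝓘(ℝ, E) x) :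
    covDerivEnd S.phi x u (Y x) =
      leviCivita 𝓘(ℝ, E) M (S.phiField Y) x u - S.phi x (leviCivita 𝓘(ℝ, E) M Y x u) :=
  (S.covDerivEnd_tensorial u).pointwise (FiberBundle.mdifferentiableAt_extend ..) hY (by simp)

theorem inner_covDerivEnd_phi (u v w : TangentSpace 𝓘(ℝ, E) x) :
    (inner ℝ (covDerivEnd S.phi x u v) w : ℝ) = -inner ℝ v (covDerivEnd S.phi x u w) := by
  set Y : Π y : M, TangentSpace 𝓘(ℝ, E) y := FiberBundle.extend E v
  set Z : Π y : M, TangentSpace 𝓘(ℝ, E) y := FiberBundle.extend E w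
  have hY : MDiffAt (T% Y) x := FiberBundle.mdifferentiableAt_extend ..
  have hZ : MDiffAt (T% Z) x := FiberBundle.mdifferentiableAt_extend ..
  have hYx : Y x = v := FiberBundle.extend_apply_self ..
  have hZx : Z x = w := FiberBundle.extend_apply_self ..
  have e : (fun y ↦ (inner ℝ (S.phiField Y y) (Z y) : ℝ)) =
      -fun y ↦ (inner ℝ (Y y) (S.phiField Z y) : ℝ) := by
    ext y; exact S.inner_phi_left y (Y y) (Z y)
  have h := mvfderiv_inner_eq (S.mdifferentiableAt_phiField hY) hZ u
  rw [e, mvfderiv_neg, neg_apply,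
    mvfderiv_inner_eq hY (S.mdifferentiableAt_phiField hZ) u] at h
  simp only [phiField, hYx, hZx, S.inner_phi_left] at h
  rw [← hYx, ← hZx, S.covDerivEnd_phi hY, S.covDerivEnd_phi hZ, inner_sub_left, inner_sub_right,
    S.inner_phi_left, hYx, hZx]
  linarith

theorem inner_leviCivita_xi_xi (u : TangentSpace 𝓘(ℝ, E) x) :
    (inner ℝ (leviCivita 𝓘(ℝ, E) M S.xi x u) (S.xi x) : ℝ) = 0 := by
  have h := mvfderiv_inner_eq S.mdifferentiableAt_xi S.mdifferentiableAt_xi u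
  simp only [S.inner_xi_xi, real_inner_comm (leviCivita 𝓘(ℝ, E) M S.xi x u)] at h
  rw [mvfderiv_const, zero_apply] at h
  linarith

theorem covDerivEnd_phi_xi (u : TangentSpace 𝓘(ℝ, E) x) :
    covDerivEnd S.phi x u (S.xi x) = -S.phi x (leviCivita 𝓘(ℝ, E) M S.xi x u) := by
  have e : S.phiField S.xi = 0 := by ext y; exact S.phi_xi y
  rw [S.covDerivEnd_phi S.mdifferentiableAt_xi, e, CovariantDerivative.zero]
  simp

theorem covDerivEnd_phi_phi (u w : TangentSpace 𝓘(ℝ, E) x) :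
    covDerivEnd S.phi x u (S.phi x w) + S.phi x (covDerivEnd S.phi x u w) =
      (inner ℝ w (leviCivita 𝓘(ℝ, E) M S.xi x u) : ℝ) • S.xi x
        + S.eta x w • leviCivita 𝓘(ℝ, E) M S.xi x u := by
  set Z : Π y : M, TangentSpace 𝓘(ℝ, E) y := FiberBundle.extend E w
  have hZ : MDiffAt (T% Z) x := FiberBundle.mdifferentiableAt_extend ..
  have hZx : Z x = w := FiberBundle.extend_apply_self ..
  have h1 := S.covDerivEnd_phi (S.mdifferentiableAt_phiField hZ) u
  have hf := mdifferentiableAt_inner hZ (S.mdifferentiableAt_xi (x := x))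
  rw [S.phiField_phiField, leviCivita_add (mdifferentiableAt_neg_section hZ)
    (hf.smul_section S.mdifferentiableAt_xi), leviCivita_smul hf S.mdifferentiableAt_xi,
    leviCivita_neg hZ, mvfderiv_inner_eq hZ S.mdifferentiableAt_xi] at h1
  simp only [phiField, hZx] at h1
  have h2 := S.covDerivEnd_phi hZ u
  rw [hZx] at h2
  rw [h1, h2, map_sub, S.phi_phi, S.eta_eq_inner, S.eta_eq_inner, add_smul]
  change _ + (S.phi x (leviCivita 𝓘(ℝ, E) M (S.phiField Z) x u) - _) = _
  abel

theorem extDerivTwoForm_fundamentalForm (u v w : TangentSpace 𝓘(ℝ, E) x) :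
    extDerivTwoForm S.fundamentalForm x u v w =
      (1 / 3 : ℝ) * (inner ℝ v (covDerivEnd S.phi x u w) + inner ℝ w (covDerivEnd S.phi x v u)
        + inner ℝ u (covDerivEnd S.phi x w v)) := by
  set X : Π y : M, TangentSpace 𝓘(ℝ, E) y := FiberBundle.extend E u with hXdef
  set Y : Π y : M, TangentSpace 𝓘(ℝ, E) y := FiberBundle.extend E v with hYdef
  set Z : Π y : M, TangentSpace 𝓘(ℝ, E) y := FiberBundle.extend E w with hZdef
  have hX : MDiffAt (T% X) x := FiberBundle.mdifferentiableAt_extend ..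
  have hY : MDiffAt (T% Y) x := FiberBundle.mdifferentiableAt_extend ..
  have hZ : MDiffAt (T% Z) x := FiberBundle.mdifferentiableAt_extend ..
  have hXx : X x = u := FiberBundle.extend_apply_self ..
  have hYx : Y x = v := FiberBundle.extend_apply_self ..
  have hZx : Z x = w := FiberBundle.extend_apply_self ..
  have hd : ∀ A B : Π y : M, TangentSpace 𝓘(ℝ, E) y, MDiffAt (T% A) x → MDiffAt (T% B) x →
      ∀ a : TangentSpace 𝓘(ℝ, E) x, d% (fun y ↦ S.fundamentalForm y (A y) (B y)) x a =
        inner ℝ (leviCivita 𝓘(ℝ, E) M A x a) (S.phi x (B x))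
          + inner ℝ (A x) (covDerivEnd S.phi x a (B x))
          - inner ℝ (S.phi x (A x)) (leviCivita 𝓘(ℝ, E) M B x a) := by
    intro A B hA hB a
    have h := mvfderiv_inner_eq hA (S.mdifferentiableAt_phiField hB) a
    rw [S.covDerivEnd_phi hB, inner_sub_right, S.inner_phi_left]
    refine h.trans ?_
    simp only [phiField]
    ring
  have hb : ∀ A B C : Π y : M, TangentSpace 𝓘(ℝ, E) y, MDiffAt (T% A) x → MDiffAt (T% B) x →
      S.fundamentalForm x (mlieBracket 𝓘(ℝ, E) A B x) (C x) =
        inner ℝ (leviCivita 𝓘(ℝ, E) M B x (A x)) (S.phi x (C x))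
          - inner ℝ (leviCivita 𝓘(ℝ, E) M A x (B x)) (S.phi x (C x)) := by
    intro A B C hA hB
    rw [← leviCivita_torsion hA hB, fundamentalForm, inner_sub_left]
  rw [extDerivTwoForm]
  simp only [← hXdef, ← hYdef, ← hZdef]
  rw [hd Y Z hY hZ, hd Z X hZ hX, hd X Y hX hY, ← hXx, ← hYx, ← hZx, hb X Y Z hX hY, hb Y Z X hY hZ,
    hb Z X Y hZ hX, real_inner_comm _ (S.phi x (X x)), real_inner_comm _ (S.phi x (Y x)),
    real_inner_comm _ (S.phi x (Z x))]
  ring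

end AlmostContactMetricStructure

end AlmostContact

section Minimum

variable {E : Type*} [NormedAddCommGroup E] [NormedSpace ℝ E]
  {M : Type*} [TopologicalSpace M] [ChartedSpace E M] {f : M → ℝ} {x : M}

theorem mvfderiv_eq_zero_of_isLocalMin (hf : MDiffAt f x) (h : IsLocalMin f x) :
    d% f x = 0 := by
  rw [hf.mvfderiv, modelWithCornersSelf_coe, Set.range_id, fderivWithin_univ]
  refine IsLocalMin.fderiv_eq_zero ?_
  have hc : Filter.Tendsto (extChartAt 𝓘(ℝ, E) x).symm
      (nhds (extChartAt 𝓘(ℝ, E) x x)) (nhds x) := by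
    simpa [ContinuousAt] using continuousAt_extChartAt_symm (I := 𝓘(ℝ, E)) x
  filter_upwards [hc.eventually h] with z hz
  simpa [writtenInExtChartAt, chartAt_self_eq] using hz

end Minimum

section Submersion

variable {E : Type*} [NormedAddCommGroup E] [NormedSpace ℝ E] [FiniteDimensional ℝ E]
  {M : Type*} [TopologicalSpace M] [ChartedSpace E M] [IsManifold 𝓘(ℝ, E) ∞ M]
  [RiemannianBundle (fun x : M ↦ TangentSpace 𝓘(ℝ, E) x)]
  [IsContMDiffRiemannianBundle 𝓘(ℝ, E) ∞ E (fun x : M ↦ TangentSpace 𝓘(ℝ, E) x)]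
  {E' : Type*} [NormedAddCommGroup E'] [NormedSpace ℝ E'] [FiniteDimensional ℝ E']
  {M' : Type*} [TopologicalSpace M'] [ChartedSpace E' M'] [IsManifold 𝓘(ℝ, E') ∞ M']
  [RiemannianBundle (fun x : M' ↦ TangentSpace 𝓘(ℝ, E') x)]
  [IsContMDiffRiemannianBundle 𝓘(ℝ, E') ∞ E' (fun x : M' ↦ TangentSpace 𝓘(ℝ, E') x)]
  {p : M → M'} {X Z U : Π x : M, TangentSpace 𝓘(ℝ, E) x}
  {X' Z' : Π x : M', TangentSpace 𝓘(ℝ, E') x} {x : M}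

theorem mem_verticalSpace {u : TangentSpace 𝓘(ℝ, E) x} :
    u ∈ verticalSpace 𝓘(ℝ, E) 𝓘(ℝ, E') p x ↔ mfderiv 𝓘(ℝ, E) 𝓘(ℝ, E') p x u = 0 :=
  LinearMap.mem_ker

theorem RelatedNear.add (hX : RelatedNear p X X' x) (hZ : RelatedNear p Z Z' x) :
    RelatedNear p (X + Z) (X' + Z') x := by
  filter_upwards [hX, hZ] with y h1 h2
  rw [Pi.add_apply, map_add, h1, h2, Pi.add_apply]

namespace IsRiemannianSubmersion

variable (hp : IsRiemannianSubmersion 𝓘(ℝ, E) 𝓘(ℝ, E') p)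
include hp

theorem norm_mfderiv_le (u : TangentSpace 𝓘(ℝ, E) x) :
    ‖mfderiv 𝓘(ℝ, E) 𝓘(ℝ, E') p x u‖ ≤ ‖u‖ := by
  set K := verticalSpace 𝓘(ℝ, E) 𝓘(ℝ, E') p x
  have h1 : mfderiv 𝓘(ℝ, E) 𝓘(ℝ, E') p x (K.starProjection u) = 0 :=
    mem_verticalSpace.1 (K.starProjection_apply_mem u)
  have h2 : mfderiv 𝓘(ℝ, E) 𝓘(ℝ, E') p x u =
      mfderiv 𝓘(ℝ, E) 𝓘(ℝ, E') p x (Kᗮ.starProjection u) := by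
    conv_lhs => rw [← K.starProjection_add_starProjection_orthogonal u]
    rw [map_add, h1, zero_add]
  rw [h2, hp.norm_mfderiv x _ (Kᗮ.starProjection_apply_mem u)]
  exact Kᗮ.norm_starProjection_apply_le u

theorem inner_leviCivita_self_eq_zero (hX : MDiffAt (T% X) x) (hX' : MDiffAt (T% X') (p x))
    (hXX' : RelatedNear p X X' x) (hXx : X x ∈ (verticalSpace 𝓘(ℝ, E) 𝓘(ℝ, E') p x)ᗮ)
    {u : TangentSpace 𝓘(ℝ, E) x} (hu : mfderiv 𝓘(ℝ, E) 𝓘(ℝ, E') p x u = 0) :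
    (inner ℝ (leviCivita 𝓘(ℝ, E) M X x u) (X x) : ℝ) = 0 := by
  have hpd : MDiffAt p x := (hp.smooth x).mdifferentiableAt (by simp)
  have hd := mdifferentiableAt_inner hX hX
  have hd' := mdifferentiableAt_inner hX' hX'
  have hd'p : MDiffAt ((fun z ↦ (inner ℝ (X' z) (X' z) : ℝ)) ∘ p) x := hd'.comp x hpd
  have hmin : IsLocalMin ((fun y ↦ (inner ℝ (X y) (X y) : ℝ)) -
      (fun z ↦ (inner ℝ (X' z) (X' z) : ℝ)) ∘ p) x := by
    have h0 : ((fun y ↦ (inner ℝ (X y) (X y) : ℝ)) -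
      (fun z ↦ (inner ℝ (X' z) (X' z) : ℝ)) ∘ p) x = 0 := by
      simp only [Pi.sub_apply, Function.comp_apply, ← hXX'.self_of_nhds, real_inner_self_eq_norm_sq,
        hp.norm_mfderiv x _ hXx, sub_self]
    filter_upwards [hXX'] with y hy
    rw [h0]
    simp only [Pi.sub_apply, Function.comp_apply, ← hy, real_inner_self_eq_norm_sq, sub_nonneg]
    have := hp.norm_mfderiv_le (X y)
    gcongr
  have h := DFunLike.congr_fun (mvfderiv_eq_zero_of_isLocalMin (hd.sub hd'p) hmin) u
  rw [mvfderiv_sub hd hd'p, sub_apply, mvfderiv_comp_apply x hd' hpd, hu, map_zero, sub_zero,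
    mvfderiv_inner_eq hX hX, real_inner_comm (leviCivita 𝓘(ℝ, E) M X x u), zero_apply] at h
  linarith

/-- The derivative of the inner product of two projectable fields along a vertical vector vanishes
at a point where the fields are horizontal. -/
theorem inner_leviCivita_add_eq_zero (hX : MDiffAt (T% X) x) (hX' : MDiffAt (T% X') (p x))
    (hXX' : RelatedNear p X X' x) (hXx : X x ∈ (verticalSpace 𝓘(ℝ, E) 𝓘(ℝ, E') p x)ᗮ)
    (hZ : MDiffAt (T% Z) x) (hZ' : MDiffAt (T% Z') (p x))
    (hZZ' : RelatedNear p Z Z' x) (hZx : Z x ∈ (verticalSpace 𝓘(ℝ, E) 𝓘(ℝ, E') p x)ᗮ)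
    {u : TangentSpace 𝓘(ℝ, E) x} (hu : mfderiv 𝓘(ℝ, E) 𝓘(ℝ, E') p x u = 0) :
    (inner ℝ (leviCivita 𝓘(ℝ, E) M X x u) (Z x) : ℝ)
      + inner ℝ (X x) (leviCivita 𝓘(ℝ, E) M Z x u) = 0 := by
  have h1 := hp.inner_leviCivita_self_eq_zero hX hX' hXX' hXx hu
  have h2 := hp.inner_leviCivita_self_eq_zero hZ hZ' hZZ' hZx hu
  have h3 := hp.inner_leviCivita_self_eq_zero (mdifferentiableAt_add_section hX hZ)
    (mdifferentiableAt_add_section hX' hZ') (hXX'.add hZZ') (Submodule.add_mem _ hXx hZx) hu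
  rw [leviCivita_add hX hZ, Pi.add_apply, inner_add_left, inner_add_right, inner_add_right, h1, h2,
    real_inner_comm (X x)] at h3
  linarith

theorem leviCivita_eq_add_vertical (hU : MDiffAt (T% U) x) (hU0 : RelatedNear (E' := E') p U 0 x)
    (hX : MDiffAt (T% X) x) (hX' : MDiffAt (T% X') (p x)) (hXX' : RelatedNear p X X' x) :
    ∃ v ∈ verticalSpace 𝓘(ℝ, E) 𝓘(ℝ, E') p x,
      leviCivita 𝓘(ℝ, E) M X x (U x) = leviCivita 𝓘(ℝ, E) M U x (X x) + v :=
  ⟨_, mem_verticalSpace.2 (mfderiv_mlieBracket_eq_zero hp.smooth hU hX hX' hU0 hXX'), by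
    rw [← leviCivita_torsion hU hX]; abel⟩

/-- A vertical vector field acts as a Killing field on horizontal vectors. -/
theorem inner_leviCivita_vertical_skew (hU : MDiffAt (T% U) x)
    (hU0 : RelatedNear (E' := E') p U 0 x) {a b : TangentSpace 𝓘(ℝ, E) x}
    (ha : a ∈ (verticalSpace 𝓘(ℝ, E) 𝓘(ℝ, E') p x)ᗮ)
    (hb : b ∈ (verticalSpace 𝓘(ℝ, E) 𝓘(ℝ, E') p x)ᗮ) :
    (inner ℝ (leviCivita 𝓘(ℝ, E) M U x a) b : ℝ)
      + inner ℝ a (leviCivita 𝓘(ℝ, E) M U x b) = 0 := by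
  obtain ⟨X, rfl, hX, hXX'⟩ := exists_relatedNear_extend hp.smooth (hp.mfderiv_surjective x) a
  obtain ⟨Z, rfl, hZ, hZZ'⟩ := exists_relatedNear_extend hp.smooth (hp.mfderiv_surjective x) b
  have hX' := FiberBundle.mdifferentiableAt_extend 𝓘(ℝ, E') E'
    (mfderiv 𝓘(ℝ, E) 𝓘(ℝ, E') p x (X x))
  have hZ' := FiberBundle.mdifferentiableAt_extend 𝓘(ℝ, E') E'
    (mfderiv 𝓘(ℝ, E) 𝓘(ℝ, E') p x (Z x))
  have h := hp.inner_leviCivita_add_eq_zero hX hX' hXX' ha hZ hZ' hZZ' hb hU0.self_of_nhds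
  obtain ⟨v, hv, e⟩ := hp.leviCivita_eq_add_vertical hU hU0 hX hX' hXX'
  obtain ⟨w, hw, e'⟩ := hp.leviCivita_eq_add_vertical hU hU0 hZ hZ' hZZ'
  rw [e, e', inner_add_left, inner_add_right, Submodule.inner_right_of_mem_orthogonal hv hb,
    Submodule.inner_left_of_mem_orthogonal hw ha] at h
  linarith

end IsRiemannianSubmersion

end Submersion

section ContactComplexSubmersion

variable {E : Type*} [NormedAddCommGroup E] [NormedSpace ℝ E] [FiniteDimensional ℝ E]
  {M : Type*} [TopologicalSpace M] [ChartedSpace E M] [IsManifold 𝓘(ℝ, E) ∞ M]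
  [RiemannianBundle (fun x : M ↦ TangentSpace 𝓘(ℝ, E) x)]
  [IsContMDiffRiemannianBundle 𝓘(ℝ, E) ∞ E (fun x : M ↦ TangentSpace 𝓘(ℝ, E) x)]
  {E' : Type*} [NormedAddCommGroup E'] [NormedSpace ℝ E'] [FiniteDimensional ℝ E']
  {M' : Type*} [TopologicalSpace M'] [ChartedSpace E' M'] [IsManifold 𝓘(ℝ, E') ∞ M']
  [RiemannianBundle (fun x : M' ↦ TangentSpace 𝓘(ℝ, E') x)]
  [IsContMDiffRiemannianBundle 𝓘(ℝ, E') ∞ E' (fun x : M' ↦ TangentSpace 𝓘(ℝ, E') x)]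
  {p : M → M'} {X Y U : Π x : M, TangentSpace 𝓘(ℝ, E) x} {x : M}
  {S : AlmostContactMetricStructure 𝓘(ℝ, E) M} {T : AlmostHermitianStructure 𝓘(ℝ, E') M'}
  {θ : Π x : M, TangentSpace 𝓘(ℝ, E) x →L[ℝ] ℝ}

/-- The 1-form `θ` satisfies the equation `dφ = -2 θ ∧ φ` that characterizes the Lee form. -/
def IsLeeForm (S : AlmostContactMetricStructure 𝓘(ℝ, E) M)
    (θ : Π x : M, TangentSpace 𝓘(ℝ, E) x →L[ℝ] ℝ) : Prop :=
  ∀ (x : M) (u v w : TangentSpace 𝓘(ℝ, E) x),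
    extDerivTwoForm S.fundamentalForm x u v w = -2 * wedgeOneTwo θ S.fundamentalForm x u v w

theorem IsLeeForm.inner_covDerivEnd (hθ : IsLeeForm S θ) (u v w : TangentSpace 𝓘(ℝ, E) x) :
    (inner ℝ v (covDerivEnd S.phi x u w) : ℝ) + inner ℝ w (covDerivEnd S.phi x v u)
        + inner ℝ u (covDerivEnd S.phi x w v) =
      -2 * (θ x u * inner ℝ v (S.phi x w) + θ x v * inner ℝ w (S.phi x u)
        + θ x w * inner ℝ u (S.phi x v)) := by
  have h := hθ x u v w
  rw [S.extDerivTwoForm_fundamentalForm, wedgeOneTwo] at h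
  simp only [AlmostContactMetricStructure.fundamentalForm] at h
  linarith

namespace IsContactComplexSubmersion

variable (hp : IsContactComplexSubmersion S T p)
include hp

theorem phi_mem_vertical {u : TangentSpace 𝓘(ℝ, E) x}
    (hu : u ∈ verticalSpace 𝓘(ℝ, E) 𝓘(ℝ, E') p x) :
    S.phi x u ∈ verticalSpace 𝓘(ℝ, E) 𝓘(ℝ, E') p x := by
  rw [mem_verticalSpace] at hu ⊢
  rw [← hp.J_mfderiv, hu, map_zero]

theorem phi_mem_horizontal {u : TangentSpace 𝓘(ℝ, E) x}
    (hu : u ∈ (verticalSpace 𝓘(ℝ, E) 𝓘(ℝ, E') p x)ᗮ) :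
    S.phi x u ∈ (verticalSpace 𝓘(ℝ, E) 𝓘(ℝ, E') p x)ᗮ := by
  intro v hv
  have h := S.inner_phi_left x v u
  rw [Submodule.inner_right_of_mem_orthogonal (hp.phi_mem_vertical hv) hu] at h
  linarith

theorem xi_mem_vertical (x : M) : S.xi x ∈ verticalSpace 𝓘(ℝ, E) 𝓘(ℝ, E') p x := by
  have h := hp.J_mfderiv x (S.xi x)
  rw [S.phi_xi, map_zero] at h
  rw [mem_verticalSpace, ← neg_eq_zero, ← T.J_J, h, map_zero]

theorem eta_horizontal {u : TangentSpace 𝓘(ℝ, E) x}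
    (hu : u ∈ (verticalSpace 𝓘(ℝ, E) 𝓘(ℝ, E') p x)ᗮ) : S.eta x u = 0 := by
  rw [S.eta_eq_inner]
  exact Submodule.inner_left_of_mem_orthogonal (hp.xi_mem_vertical x) hu

theorem relatedNear_xi (x : M) : RelatedNear (E' := E') p S.xi 0 x :=
  .of_forall fun y ↦ mem_verticalSpace.1 (hp.xi_mem_vertical y)

theorem relatedNear_phiField_zero (hU : RelatedNear (E' := E') p U 0 x) :
    RelatedNear (E' := E') p (S.phiField U) 0 x := by
  filter_upwards [hU] with y hy
  exact mem_verticalSpace.1 (hp.phi_mem_vertical (mem_verticalSpace.2 hy))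

/-- A vertical vector field preserves the fundamental form on horizontal vectors. -/
theorem fundamentalForm_lie_vertical (hU : MDiffAt (T% U) x)
    (hU0 : RelatedNear (E' := E') p U 0 x) {a b : TangentSpace 𝓘(ℝ, E) x}
    (ha : a ∈ (verticalSpace 𝓘(ℝ, E) 𝓘(ℝ, E') p x)ᗮ)
    (hb : b ∈ (verticalSpace 𝓘(ℝ, E) 𝓘(ℝ, E') p x)ᗮ) :
    (inner ℝ (leviCivita 𝓘(ℝ, E) M U x a) (S.phi x b) : ℝ)
      + inner ℝ a (S.phi x (leviCivita 𝓘(ℝ, E) M U x b))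
      + inner ℝ a (covDerivEnd S.phi x (U x) b) = 0 := by
  obtain ⟨X, rfl, hX, hXX'⟩ := exists_relatedNear_extend hp.smooth (hp.mfderiv_surjective x) a
  obtain ⟨Z, rfl, hZ, hZZ'⟩ := exists_relatedNear_extend hp.smooth (hp.mfderiv_surjective x) b
  have hX' := FiberBundle.mdifferentiableAt_extend 𝓘(ℝ, E') E'
    (mfderiv 𝓘(ℝ, E) 𝓘(ℝ, E') p x (X x))
  have hZ' := FiberBundle.mdifferentiableAt_extend 𝓘(ℝ, E') E'
    (mfderiv 𝓘(ℝ, E) 𝓘(ℝ, E') p x (Z x))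
  set Z' : Π y : M', TangentSpace 𝓘(ℝ, E') y :=
    FiberBundle.extend E' (mfderiv 𝓘(ℝ, E) 𝓘(ℝ, E') p x (Z x))
  have hJZ' : MDiffAt (T% (fun y ↦ T.J y (Z' y))) (p x) :=
    ((T.J_smooth (p x)).mdifferentiableAt (by simp)).clm_bundle_apply hZ'
  have hJ : RelatedNear p (S.phiField Z) (fun y ↦ T.J y (Z' y)) x := by
    filter_upwards [hZZ'] with y hy
    rw [AlmostContactMetricStructure.phiField, ← hp.J_mfderiv, hy]
  have hφb := hp.phi_mem_horizontal hb
  have h := hp.inner_leviCivita_add_eq_zero hX hX' hXX' ha (S.mdifferentiableAt_phiField hZ) hJZ'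
    hJ hφb hU0.self_of_nhds
  obtain ⟨v, hv, e⟩ := hp.leviCivita_eq_add_vertical hU hU0 hX hX' hXX'
  obtain ⟨w, hw, e'⟩ := hp.leviCivita_eq_add_vertical hU hU0 hZ hZ' hZZ'
  rw [S.covDerivEnd_phi hZ, inner_sub_right, e', map_add, inner_add_right,
    Submodule.inner_left_of_mem_orthogonal (hp.phi_mem_vertical hw) ha]
  rw [e, inner_add_left] at h
  change _ + inner ℝ v (S.phi x (Z x)) + _ = _ at h
  rw [Submodule.inner_right_of_mem_orthogonal hv hφb] at h
  simp only [AlmostContactMetricStructure.phiField] at h ⊢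
  linarith

theorem leeForm_xi_mul (hθ : IsLeeForm S θ) {a b : TangentSpace 𝓘(ℝ, E) x}
    (ha : a ∈ (verticalSpace 𝓘(ℝ, E) 𝓘(ℝ, E') p x)ᗮ)
    (hb : b ∈ (verticalSpace 𝓘(ℝ, E) 𝓘(ℝ, E') p x)ᗮ) :
    θ x (S.xi x) * inner ℝ a (S.phi x b) = 0 := by
  have h := hp.fundamentalForm_lie_vertical S.mdifferentiableAt_xi (hp.relatedNear_xi x) ha hb
  have h' := hθ.inner_covDerivEnd (S.xi x) a b
  have e := S.inner_covDerivEnd_phi b (S.xi x) a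
  have e1 := S.inner_phi_left x (leviCivita 𝓘(ℝ, E) M S.xi x b) a
  have e2 := S.inner_phi_left x b (leviCivita 𝓘(ℝ, E) M S.xi x a)
  have e3 : (inner ℝ (S.xi x) (S.phi x a) : ℝ) = 0 := by
    rw [real_inner_comm, ← S.eta_eq_inner, S.eta_phi]
  rw [S.covDerivEnd_phi_xi, inner_neg_left] at e
  rw [S.covDerivEnd_phi_xi, inner_neg_right, S.phi_xi, inner_zero_right, e3] at h'
  have c1 := real_inner_comm a (S.phi x (leviCivita 𝓘(ℝ, E) M S.xi x b))
  have c2 := real_inner_comm (S.phi x b) (leviCivita 𝓘(ℝ, E) M S.xi x a)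
  linarith

/-- The Lee form of the total space vanishes on the characteristic vector field. -/
theorem leeForm_xi [Nontrivial E'] (hθ : IsLeeForm S θ) (x : M) : θ x (S.xi x) = 0 := by
  obtain ⟨w, hw⟩ := exists_ne (0 : E')
  obtain ⟨u, hu⟩ := hp.mfderiv_surjective x w
  set K := verticalSpace 𝓘(ℝ, E) 𝓘(ℝ, E') p x with hK
  have hb : Kᗮ.starProjection u ∈ Kᗮ := Kᗮ.starProjection_apply_mem u
  set b := Kᗮ.starProjection u with hbdef
  have hb0 : b ≠ 0 := by
    intro h0
    have h1 : mfderiv 𝓘(ℝ, E) 𝓘(ℝ, E') p x (K.starProjection u) = 0 :=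
      mem_verticalSpace.1 (K.starProjection_apply_mem u)
    have h2 : K.starProjection u = u := by
      conv_rhs => rw [← K.starProjection_add_starProjection_orthogonal u]
      rw [← hbdef, h0, add_zero]
    rw [h2, hu] at h1
    exact hw h1
  have h := hp.leeForm_xi_mul hθ (hp.phi_mem_horizontal hb) hb
  rw [S.inner_phi_phi, hp.eta_horizontal hb, mul_zero, sub_zero] at h
  exact (mul_eq_zero.1 h).resolve_right (inner_self_ne_zero.2 hb0)

theorem inner_leviCivita_vertical (hθ : IsLeeForm S θ) (hU : MDiffAt (T% U) x)
    (hU0 : RelatedNear (E' := E') p U 0 x) {a b : TangentSpace 𝓘(ℝ, E) x}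
    (ha : a ∈ (verticalSpace 𝓘(ℝ, E) 𝓘(ℝ, E') p x)ᗮ)
    (hb : b ∈ (verticalSpace 𝓘(ℝ, E) 𝓘(ℝ, E') p x)ᗮ) :
    (inner ℝ (leviCivita 𝓘(ℝ, E) M U x a) b : ℝ) =
      S.eta x (U x) * inner ℝ (leviCivita 𝓘(ℝ, E) M S.xi x a) b
        + θ x (S.phi x (U x)) * inner ℝ a (S.phi x b) := by
  have hW := S.mdifferentiableAt_phiField hU
  have hW0 := hp.relatedNear_phiField_zero hU0
  have hφW := S.mdifferentiableAt_phiField hW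
  have hφW0 := hp.relatedNear_phiField_zero hW0
  set W := S.phiField U with hWdef
  have hWx : W x ∈ verticalSpace 𝓘(ℝ, E) 𝓘(ℝ, E') p x := mem_verticalSpace.2 hW0.self_of_nhds
  have lie := hp.fundamentalForm_lie_vertical hW hW0 ha hb
  have skew := hp.inner_leviCivita_vertical_skew hφW hφW0 ha hb
  have lee := hθ.inner_covDerivEnd (W x) a b
  rw [Submodule.inner_left_of_mem_orthogonal (hp.phi_mem_vertical hWx) hb,
    Submodule.inner_right_of_mem_orthogonal hWx (hp.phi_mem_horizontal ha),
    real_inner_comm (covDerivEnd S.phi x b a), S.inner_covDerivEnd_phi, S.covDerivEnd_phi hW,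
    S.covDerivEnd_phi hW, inner_sub_right, inner_sub_right] at lee
  have e2 := S.inner_phi_left x b (leviCivita 𝓘(ℝ, E) M W x a)
  have c1 := real_inner_comm b (leviCivita 𝓘(ℝ, E) M (S.phiField W) x a)
  have c2 := real_inner_comm (S.phi x b) (leviCivita 𝓘(ℝ, E) M W x a)
  have key : (inner ℝ (leviCivita 𝓘(ℝ, E) M (S.phiField W) x a) b : ℝ) =
      -(θ x (W x) * inner ℝ a (S.phi x b)) := by linarith
  have hf := mdifferentiableAt_inner hU (S.mdifferentiableAt_xi (x := x))
  rw [hWdef, S.phiField_phiField, leviCivita_add (mdifferentiableAt_neg_section hU)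
    (hf.smul_section S.mdifferentiableAt_xi), leviCivita_smul hf S.mdifferentiableAt_xi,
    leviCivita_neg hU, inner_add_left, inner_add_left, inner_neg_left, real_inner_smul_left,
    real_inner_smul_left, Submodule.inner_right_of_mem_orthogonal (hp.xi_mem_vertical x) hb,
    ← S.eta_eq_inner] at key
  simp only [AlmostContactMetricStructure.phiField] at key
  linarith

end IsContactComplexSubmersion

theorem codiff_eta (S : AlmostContactMetricStructure 𝓘(ℝ, E) M) (x : M) :
    codiff S.eta x =
      -LinearMap.trace ℝ _ (leviCivita 𝓘(ℝ, E) M S.xi x : TangentSpace 𝓘(ℝ, E) x →ₗ[ℝ] _) := by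
  rw [codiff, LinearMap.trace_eq_sum_inner _ (stdOrthonormalBasis ℝ (TangentSpace 𝓘(ℝ, E) x))]
  congr 1
  refine Finset.sum_congr rfl fun i _ ↦ ?_
  set u := stdOrthonormalBasis ℝ (TangentSpace 𝓘(ℝ, E) x) i
  have hW := FiberBundle.mdifferentiableAt_extend 𝓘(ℝ, E) E u
  have h := mvfderiv_inner_eq hW (S.mdifferentiableAt_xi (x := x)) u
  simp only [← S.eta_eq_inner] at h
  rw [covDerivOneForm, h, FiberBundle.extend_apply_self, S.eta_eq_inner]
  simp

theorem IsLeeForm.codiff_eta_eq_zero (hθ : IsLeeForm S θ) (h : θ x (S.xi x) = 0) :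
    codiff S.eta x = 0 := by
  set A : TangentSpace 𝓘(ℝ, E) x →ₗ[ℝ] TangentSpace 𝓘(ℝ, E) x :=
    (leviCivita 𝓘(ℝ, E) M S.xi x : TangentSpace 𝓘(ℝ, E) x →ₗ[ℝ] TangentSpace 𝓘(ℝ, E) x) with hA
  set F : TangentSpace 𝓘(ℝ, E) x →ₗ[ℝ] TangentSpace 𝓘(ℝ, E) x :=
    (S.phi x : TangentSpace 𝓘(ℝ, E) x →ₗ[ℝ] TangentSpace 𝓘(ℝ, E) x) with hF
  set N : TangentSpace 𝓘(ℝ, E) x →ₗ[ℝ] TangentSpace 𝓘(ℝ, E) x :=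
    (TensorialAt.mkHom _ x (S.covDerivEnd_tensorial (S.xi x)) :
      TangentSpace 𝓘(ℝ, E) x →ₗ[ℝ] TangentSpace 𝓘(ℝ, E) x) with hN
  have hNapp : ∀ w, N w = covDerivEnd S.phi x (S.xi x) w := fun _ ↦ rfl
  set e : TangentSpace 𝓘(ℝ, E) x →ₗ[ℝ] ℝ := (S.eta x : TangentSpace 𝓘(ℝ, E) x →ₗ[ℝ] ℝ) with he
  have hAξ : e (A (S.xi x)) = 0 :=
    (S.eta_eq_inner x _).trans (S.inner_leviCivita_xi_xi (S.xi x))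
  have h1 : LinearMap.trace ℝ _ (F * (A * F)) = -LinearMap.trace ℝ _ A := by
    have hFF : A * F * F = -A + e.smulRight (A (S.xi x)) := by
      ext w
      have := congrArg A (S.phi_phi x w)
      rw [map_add, map_neg, map_smul] at this
      exact this
    rw [LinearMap.trace_mul_comm, hFF, map_add, map_neg, LinearMap.trace_smulRight, hAξ, add_zero]
  have h2 : LinearMap.trace ℝ _ (F * N) = 0 := by
    have hNF : N * F + F * N = (innerₗ (TangentSpace 𝓘(ℝ, E) x) (A (S.xi x))).smulRight (S.xi x)
        + e.smulRight (A (S.xi x)) := by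
      ext w
      have := S.covDerivEnd_phi_phi (S.xi x) w
      rw [real_inner_comm] at this
      exact this
    have := congrArg (LinearMap.trace ℝ _) hNF
    rw [map_add, map_add, LinearMap.trace_smulRight, LinearMap.trace_smulRight, hAξ,
      LinearMap.trace_mul_comm, innerₗ_apply_apply] at this
    have h0 := S.inner_leviCivita_xi_xi (S.xi x)
    change _ + _ = inner ℝ (leviCivita 𝓘(ℝ, E) M S.xi x (S.xi x)) (S.xi x) + _ at this
    linarith
  have h3 : LinearMap.trace ℝ _ (A - F * N - F * (A * F)) = 0 := by
    rw [LinearMap.trace_eq_sum_inner _ (stdOrthonormalBasis ℝ (TangentSpace 𝓘(ℝ, E) x))]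
    refine Finset.sum_eq_zero fun i _ ↦ ?_
    set w := stdOrthonormalBasis ℝ (TangentSpace 𝓘(ℝ, E) x) i
    have lee := hθ.inner_covDerivEnd (S.xi x) (S.phi x w) w
    have a1 : (inner ℝ (S.xi x) (S.phi x (S.phi x w)) : ℝ) = 0 := by
      rw [real_inner_comm, ← S.eta_eq_inner, S.eta_phi]
    have a2 := S.inner_covDerivEnd_phi w (S.xi x) (S.phi x w)
    rw [S.covDerivEnd_phi_xi, inner_neg_left, S.inner_phi_phi, S.eta_eq_inner,
      S.inner_leviCivita_xi_xi, real_inner_comm] at a2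
    rw [h, a1, S.phi_xi, inner_zero_right, S.covDerivEnd_phi_xi, inner_neg_right,
      S.inner_phi_left] at lee
    change (inner ℝ w (leviCivita 𝓘(ℝ, E) M S.xi x w - S.phi x (covDerivEnd S.phi x (S.xi x) w)
      - S.phi x (leviCivita 𝓘(ℝ, E) M S.xi x (S.phi x w))) : ℝ) = 0
    rw [inner_sub_right, inner_sub_right]
    linarith
  rw [map_sub, map_sub, h1, h2] at h3
  rw [codiff_eta]
  linarith

end ContactComplexSubmersion

section ONeill

variable {E : Type*} [NormedAddCommGroup E] [NormedSpace ℝ E] [FiniteDimensional ℝ E]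
  {M : Type*} [TopologicalSpace M] [ChartedSpace E M] [IsManifold 𝓘(ℝ, E) ∞ M]
  [RiemannianBundle (fun x : M ↦ TangentSpace 𝓘(ℝ, E) x)]
  [IsContMDiffRiemannianBundle 𝓘(ℝ, E) ∞ E (fun x : M ↦ TangentSpace 𝓘(ℝ, E) x)]
  {E' : Type*} [NormedAddCommGroup E'] [NormedSpace ℝ E'] [FiniteDimensional ℝ E']
  {M' : Type*} [TopologicalSpace M'] [ChartedSpace E' M'] [IsManifold 𝓘(ℝ, E') ∞ M']
  {p : M → M'} {X Y U : Π x : M, TangentSpace 𝓘(ℝ, E) x} {x : M}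

theorem hor_eq_self (hX : ∀ y, X y ∈ (verticalSpace 𝓘(ℝ, E) 𝓘(ℝ, E') p y)ᗮ) :
    hor 𝓘(ℝ, E) 𝓘(ℝ, E') p X = X :=
  funext fun y ↦ Submodule.starProjection_eq_self_iff.2 (hX y)

theorem vert_eq_self (hU : ∀ y, U y ∈ verticalSpace 𝓘(ℝ, E) 𝓘(ℝ, E') p y) :
    vert 𝓘(ℝ, E) 𝓘(ℝ, E') p U = U :=
  funext fun y ↦ Submodule.starProjection_eq_self_iff.2 (hU y)

theorem vert_eq_zero (hX : ∀ y, X y ∈ (verticalSpace 𝓘(ℝ, E) 𝓘(ℝ, E') p y)ᗮ) :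
    vert 𝓘(ℝ, E) 𝓘(ℝ, E') p X = 0 :=
  funext fun y ↦ (Submodule.starProjection_apply_eq_zero_iff _).2 (hX y)

theorem hor_eq_zero (hU : ∀ y, U y ∈ verticalSpace 𝓘(ℝ, E) 𝓘(ℝ, E') p y) :
    hor 𝓘(ℝ, E) 𝓘(ℝ, E') p U = 0 :=
  funext fun y ↦ (Submodule.starProjection_apply_eq_zero_iff _).2
    (Submodule.le_orthogonal_orthogonal _ (hU y))

theorem oneillA_vertical (hX : ∀ y, X y ∈ (verticalSpace 𝓘(ℝ, E) 𝓘(ℝ, E') p y)ᗮ)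
    (hU : ∀ y, U y ∈ verticalSpace 𝓘(ℝ, E) 𝓘(ℝ, E') p y) (x : M) :
    oneillA 𝓘(ℝ, E) 𝓘(ℝ, E') p X U x =
      (verticalSpace 𝓘(ℝ, E) 𝓘(ℝ, E') p x)ᗮ.starProjection
        (leviCivita 𝓘(ℝ, E) M U x (X x)) := by
  rw [oneillA, hor_eq_self hX, hor_eq_zero hU, vert_eq_self hU]
  simp [vert, hor]

theorem oneillA_horizontal (hX : ∀ y, X y ∈ (verticalSpace 𝓘(ℝ, E) 𝓘(ℝ, E') p y)ᗮ)
    (hY : ∀ y, Y y ∈ (verticalSpace 𝓘(ℝ, E) 𝓘(ℝ, E') p y)ᗮ) (x : M) :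
    oneillA 𝓘(ℝ, E) 𝓘(ℝ, E') p X Y x =
      (verticalSpace 𝓘(ℝ, E) 𝓘(ℝ, E') p x).starProjection
        (leviCivita 𝓘(ℝ, E) M Y x (X x)) := by
  rw [oneillA, hor_eq_self hX, hor_eq_self hY, vert_eq_zero hY]
  simp [vert, hor]

theorem eq_of_forall_inner_eq {V : Type*} [NormedAddCommGroup V] [InnerProductSpace ℝ V]
    {K : Submodule ℝ V} {a b : V} (ha : a ∈ K) (hb : b ∈ K)
    (h : ∀ c ∈ K, (inner ℝ a c : ℝ) = inner ℝ b c) : a = b := by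
  rw [← sub_eq_zero, ← inner_self_eq_zero (𝕜 := ℝ), inner_sub_left, sub_eq_zero]
  exact h _ (K.sub_mem ha hb)

variable [RiemannianBundle (fun x : M' ↦ TangentSpace 𝓘(ℝ, E') x)]
  [IsContMDiffRiemannianBundle 𝓘(ℝ, E') ∞ E' (fun x : M' ↦ TangentSpace 𝓘(ℝ, E') x)]
  {S : AlmostContactMetricStructure 𝓘(ℝ, E) M} {T : AlmostHermitianStructure 𝓘(ℝ, E') M'}
  {θ : Π x : M, TangentSpace 𝓘(ℝ, E) x →L[ℝ] ℝ}

theorem inner_starProjection_of_mem {V : Type*} [NormedAddCommGroup V] [InnerProductSpace ℝ V]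
    {K : Submodule ℝ V} [K.HasOrthogonalProjection] (a : V) {c : V} (hc : c ∈ K) :
    (inner ℝ (K.starProjection a) c : ℝ) = inner ℝ a c := by
  rw [Submodule.inner_starProjection_left_eq_right, Submodule.starProjection_eq_self_iff.2 hc]

namespace IsContactComplexSubmersion

variable (hp : IsContactComplexSubmersion S T p) (hθ : IsLeeForm S θ)
include hp hθ

theorem oneillA_vertical_eq (hX : ∀ y, X y ∈ (verticalSpace 𝓘(ℝ, E) 𝓘(ℝ, E') p y)ᗮ)
    (hU : ∀ y, U y ∈ verticalSpace 𝓘(ℝ, E) 𝓘(ℝ, E') p y) (hUd : MDiffAt (T% U) x) :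
    oneillA 𝓘(ℝ, E) 𝓘(ℝ, E') p X U x =
      S.eta x (U x) • oneillA 𝓘(ℝ, E) 𝓘(ℝ, E') p X S.xi x
        - θ x (S.phi x (U x)) • S.phi x (X x) := by
  rw [oneillA_vertical hX hU, oneillA_vertical hX hp.xi_mem_vertical]
  set K := verticalSpace 𝓘(ℝ, E) 𝓘(ℝ, E') p x
  refine eq_of_forall_inner_eq (K := Kᗮ) (Submodule.starProjection_apply_mem _ _)
    (Submodule.sub_mem _ (Submodule.smul_mem _ _ (Submodule.starProjection_apply_mem _ _))
      (Submodule.smul_mem _ _ (hp.phi_mem_horizontal (hX x)))) fun b hb ↦ ?_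
  rw [inner_sub_left, real_inner_smul_left, real_inner_smul_left, inner_starProjection_of_mem _ hb,
    inner_starProjection_of_mem _ hb, S.inner_phi_left,
    hp.inner_leviCivita_vertical hθ hUd (.of_forall fun y ↦ mem_verticalSpace.1 (hU y)) (hX x) hb]
  ring

theorem oneillA_horizontal_eq (hX : ∀ y, X y ∈ (verticalSpace 𝓘(ℝ, E) 𝓘(ℝ, E') p y)ᗮ)
    (hY : ∀ y, Y y ∈ (verticalSpace 𝓘(ℝ, E) 𝓘(ℝ, E') p y)ᗮ) (hYd : MDiffAt (T% Y) x) :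
    oneillA 𝓘(ℝ, E) 𝓘(ℝ, E') p X Y x =
      S.eta x (oneillA 𝓘(ℝ, E) 𝓘(ℝ, E') p X Y x) • S.xi x
        + S.fundamentalForm x (X x) (Y x) •
          vert 𝓘(ℝ, E) 𝓘(ℝ, E') p (S.phiField (sharp θ)) x := by
  have hA : ∀ u ∈ verticalSpace 𝓘(ℝ, E) 𝓘(ℝ, E') p x,
      (inner ℝ (leviCivita 𝓘(ℝ, E) M Y x (X x)) u : ℝ) =
        -(S.eta x u * inner ℝ (leviCivita 𝓘(ℝ, E) M S.xi x (X x)) (Y x)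
          + θ x (S.phi x u) * inner ℝ (X x) (S.phi x (Y x))) := by
    intro u hu
    obtain ⟨U, rfl, hU, hU0⟩ := exists_relatedNear_zero hp.smooth (hp.mfderiv_surjective x)
      (mem_verticalSpace.1 hu)
    have hz : (fun y ↦ (inner ℝ (Y y) (U y) : ℝ)) =ᶠ[nhds x] fun _ ↦ 0 := by
      filter_upwards [hU0] with y hy
      exact Submodule.inner_left_of_mem_orthogonal (mem_verticalSpace.2 hy) (hY y)
    have hd : d% (fun y ↦ (inner ℝ (Y y) (U y) : ℝ)) x (X x) = d% (fun _ : M ↦ (0 : ℝ)) x (X x) :=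
      DFunLike.congr_fun (hz.mfderiv_eq (I := 𝓘(ℝ, E)) (I' := 𝓘(ℝ, ℝ))) (X x)
    rw [mvfderiv_const, zero_apply, mvfderiv_inner_eq hYd hU, real_inner_comm _ (Y x),
      hp.inner_leviCivita_vertical hθ hU hU0 (hX x) (hY x)] at hd
    linarith
  have hξ := hA _ (hp.xi_mem_vertical x)
  rw [S.eta_xi, S.phi_xi, map_zero] at hξ
  rw [oneillA_horizontal hX hY]
  refine eq_of_forall_inner_eq (K := verticalSpace 𝓘(ℝ, E) 𝓘(ℝ, E') p x)
    (Submodule.starProjection_apply_mem _ _) (Submodule.add_mem _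
      (Submodule.smul_mem _ _ (hp.xi_mem_vertical x))
      (Submodule.smul_mem _ _ (Submodule.starProjection_apply_mem _ _))) fun u hu ↦ ?_
  have hsharp : (inner ℝ (S.phi x (sharp θ x)) u : ℝ) = -θ x (S.phi x u) := by
    have : CompleteSpace (TangentSpace 𝓘(ℝ, E) x) := FiniteDimensional.complete ℝ _
    rw [S.inner_phi_left, sharp, InnerProductSpace.toDual_symm_apply]
  rw [inner_add_left, real_inner_smul_left, real_inner_smul_left, vert,
    inner_starProjection_of_mem _ hu, inner_starProjection_of_mem _ hu,
    AlmostContactMetricStructure.phiField, hsharp, S.eta_eq_inner,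
    inner_starProjection_of_mem _ (hp.xi_mem_vertical x), hA u hu, hξ,
    real_inner_comm u, ← S.eta_eq_inner, AlmostContactMetricStructure.fundamentalForm]
  ring

end IsContactComplexSubmersion

/-- The Lee form of an `α`-Kenmotsu manifold is `-α η`. -/
theorem AlmostContactMetricStructure.IsAlphaKenmotsu.isLeeForm {α : M → ℝ}
    (h : S.IsAlphaKenmotsu α) : IsLeeForm S (fun x ↦ -α x • S.eta x) := by
  intro x u v w
  rw [S.extDerivTwoForm_fundamentalForm, wedgeOneTwo, h, h, h]
  simp only [inner_sub_right, inner_smul_right, ← S.eta_eq_inner, fundamentalForm, smul_apply,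
    smul_eq_mul, neg_mul]
  have s1 := S.inner_phi_left x
  have c : ∀ a b : TangentSpace 𝓘(ℝ, E) x,
      (inner ℝ a (S.phi x b) : ℝ) = -inner ℝ b (S.phi x a) := fun a b ↦ by
    rw [real_inner_comm, s1]
  rw [s1, s1, s1, c v u, c w v, c u w]
  ring

end ONeill
end ContactComplex

open ContactComplex
theorem proposition1
    {E : Type*} [NormedAddCommGroup E] [NormedSpace ℝ E] [FiniteDimensional ℝ E]
    {E' : Type*} [NormedAddCommGroup E'] [NormedSpace ℝ E'] [FiniteDimensional ℝ E']
    {M : Type*} [TopologicalSpace M] [T2Space M] [SecondCountableTopology M]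
    [ChartedSpace E M] [IsManifold 𝓘(ℝ, E) ∞ M]
    [RiemannianBundle (fun x : M ↦ TangentSpace 𝓘(ℝ, E) x)]
    [IsContMDiffRiemannianBundle 𝓘(ℝ, E) ∞ E (fun x : M ↦ TangentSpace 𝓘(ℝ, E) x)]
    {M' : Type*} [TopologicalSpace M'] [T2Space M'] [SecondCountableTopology M']
    [ChartedSpace E' M'] [IsManifold 𝓘(ℝ, E') ∞ M']
    [RiemannianBundle (fun x : M' ↦ TangentSpace 𝓘(ℝ, E') x)]
    [IsContMDiffRiemannianBundle 𝓘(ℝ, E') ∞ E' (fun x : M' ↦ TangentSpace 𝓘(ℝ, E') x)]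
    (m n : ℕ) (hm : 2 ≤ m) (hn : 1 ≤ n)
    (hE : Module.finrank ℝ E = 2 * m + 1) (hE' : Module.finrank ℝ E' = 2 * n)
    (S : AlmostContactMetricStructure 𝓘(ℝ, E) M)
    (T : AlmostHermitianStructure 𝓘(ℝ, E') M') :
    (∀ p : M → M', IsContactComplexSubmersion S T p →
      ∀ θ : Π x : M, TangentSpace 𝓘(ℝ, E) x →L[ℝ] ℝ,
      (∀ (x : M) (u v w : TangentSpace 𝓘(ℝ, E) x),
        extDerivTwoForm S.fundamentalForm x u v w =
          -2 * wedgeOneTwo θ S.fundamentalForm x u v w) →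
      (∀ x : M, codiff S.eta x = 0) ∧
      (∀ X Y U : Π x : M, TangentSpace 𝓘(ℝ, E) x,
        IsHorizontalField 𝓘(ℝ, E) 𝓘(ℝ, E') p X →
        IsHorizontalField 𝓘(ℝ, E) 𝓘(ℝ, E') p Y →
        IsVerticalField 𝓘(ℝ, E) 𝓘(ℝ, E') p U →
        ∀ x : M,
          (oneillA 𝓘(ℝ, E) 𝓘(ℝ, E') p X U x =
            S.eta x (U x) • oneillA 𝓘(ℝ, E) 𝓘(ℝ, E') p X S.xi x
              - θ x (S.phi x (U x)) • S.phi x (X x)) ∧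
          (oneillA 𝓘(ℝ, E) 𝓘(ℝ, E') p X Y x =
            S.eta x (oneillA 𝓘(ℝ, E) 𝓘(ℝ, E') p X Y x) • S.xi x
              + S.fundamentalForm x (X x) (Y x) •
                vert 𝓘(ℝ, E) 𝓘(ℝ, E') p (S.phiField (sharp θ)) x) ∧
          (oneillA 𝓘(ℝ, E) 𝓘(ℝ, E') p (S.phiField X) U x
              - S.phi x (oneillA 𝓘(ℝ, E) 𝓘(ℝ, E') p X U x) =
            S.eta x (U x) • (oneillA 𝓘(ℝ, E) 𝓘(ℝ, E') p (S.phiField X) S.xi x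
              - S.phi x (oneillA 𝓘(ℝ, E) 𝓘(ℝ, E') p X S.xi x))) ∧
          (oneillA 𝓘(ℝ, E) 𝓘(ℝ, E') p X Y x
              - oneillA 𝓘(ℝ, E) 𝓘(ℝ, E') p (S.phiField X) (S.phiField Y) x =
            S.eta x (oneillA 𝓘(ℝ, E) 𝓘(ℝ, E') p X Y x
              - oneillA 𝓘(ℝ, E) 𝓘(ℝ, E') p (S.phiField X) (S.phiField Y) x) • S.xi x))) ∧
    (∀ α : M → ℝ, S.IsAlphaKenmotsu α → (∃ x : M, α x ≠ 0) →
      ¬ ∃ p : M → M', IsContactComplexSubmersion S T p) := by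
  have : Nontrivial E' := Module.nontrivial_of_finrank_pos (R := ℝ) (by omega)
  refine ⟨fun p hp θ hθ ↦ ⟨fun x ↦ ?_, fun X Y U hX hY hU x ↦ ?_⟩, ?_⟩
  · exact IsLeeForm.codiff_eta_eq_zero hθ (hp.leeForm_xi hθ x)
  · have hφ : ∀ Z : Π x : M, TangentSpace 𝓘(ℝ, E) x, IsHorizontalField 𝓘(ℝ, E) 𝓘(ℝ, E') p Z →
        ∀ y, S.phiField Z y ∈ (verticalSpace 𝓘(ℝ, E) 𝓘(ℝ, E') p y)ᗮ :=
      fun Z hZ y ↦ hp.phi_mem_horizontal (hZ.2 y)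
    have hUd : MDiffAt (T% U) x := (hU.1 x).mdifferentiableAt (by simp)
    have hYd : MDiffAt (T% Y) x := (hY.1 x).mdifferentiableAt (by simp)
    have e1 := hp.oneillA_vertical_eq hθ hX.2 hU.2 hUd
    have e2 := hp.oneillA_horizontal_eq hθ hX.2 hY.2 hYd
    have e3 := hp.oneillA_vertical_eq hθ (hφ X hX) hU.2 hUd
    have e4 := hp.oneillA_horizontal_eq hθ (hφ X hX) (hφ Y hY) (S.mdifferentiableAt_phiField hYd)
    refine ⟨e1, e2, ?_, ?_⟩
    · rw [e1, e3, map_sub, map_smul, map_smul, smul_sub]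
      simp only [AlmostContactMetricStructure.phiField]
      abel
    · have e5 : S.fundamentalForm x (S.phiField X x) (S.phiField Y x) =
          S.fundamentalForm x (X x) (Y x) := by
        simp only [AlmostContactMetricStructure.fundamentalForm,
          AlmostContactMetricStructure.phiField]
        rw [S.inner_phi_phi, hp.eta_horizontal (hX.2 x), zero_mul, sub_zero]
      rw [e5] at e4
      rw [map_sub, sub_smul]
      nth_rewrite 1 [e2]
      nth_rewrite 1 [e4]
      abel
  · rintro α hα ⟨x, hx⟩ ⟨p, hp⟩
    have h := hp.leeForm_xi hα.isLeeForm x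
    simp only [smul_apply, S.eta_xi, smul_eq_mul, mul_one, neg_eq_zero] at h
    exact hx h
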